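/- For a group $G$ let $\gamma_1(G)=G$, $\gamma_{\alpha+1}(G)=[\gamma_\alpha(G),G]$ for every ordinal $\alpha\ge 1$, and $\gamma_\alpha(G)=\bigcap_{1\le\beta<\alpha}\gamma_\beta(G)$ for every limit ordinal $\alpha$. The length of the lower central series of $G$ is the smallest ordinal $\alpha\ge 1$ such that $\gamma_\alpha(G)=\gamma_{\alpha+1}(G)$. Let $F_2=\langle x,y\rangle$ be the free group of rank $2$ with free generators $x,y$, let $\varphi\in\mathrm{Aut}(F_2)$, and let $$G=F_2\rtimes_\varphi\mathbb{Z}=\langle x,y,t\mid t^{-1}xt=\varphi(x),\ t^{-1}yt=\varphi(y)\rangle .$$ Let $[\overline\varphi]\in\mathrm{GL}_2(\mathbb{Z})$ be the matrix of the automorphism $\overline\varphi$ of $F_2^{ab}=F_2/\gamma_2(F_2)\cong\mathbb{Z}^2$ induced by $\varphi$, in the basis given by the images of $x,y$. Suppose that $\det[\overline\varphi]=-1$ and that $\mathrm{tr}[\overline\varphi]$ is odd and different from $1$ and $-1$. Then the length of the lower central series of $G$ is equal to $\omega^2$. Moreover, $[x,y]=x^{-1}y^{-1}xy\in\gamma_\omega(G)$,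 and in particular $\gamma_\omega(G)\ne 1$. -/

import Mathlib

/-- The transfinite lower central series `γ_α(G)` of a group `G`, with the indexing
`γ₁(G) = G`, `γ_{α+1}(G) = [γ_α(G), G]` for `α ≥ 1`, and `γ_α(G) = ⋂_{β < α} γ_β(G)` for a limit
ordinal `α`. The index `0` is not part of the series; it carries the value `G`, so that it does
not influence the intersections. -/
noncomputable def transLowerCentral.{u} (G : Type u) [Group G] (α : Ordinal.{u}) : Subgroup G :=
  Ordinal.limitRecOn (motive := fun _ => Subgroup G) α ⊤
    (fun β H => if β = 0 then ⊤ else ⁅H, (⊤ : Subgroup G)⁆)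
    (fun α _ H => ⨅ (β : Ordinal.{u}) (h : β < α), H β h)

theorem transLowerCentral_zero.{u} (G : Type u) [Group G] : transLowerCentral G 0 = ⊤ := by
  simp [transLowerCentral]

theorem transLowerCentral_one.{u} (G : Type u) [Group G] : transLowerCentral G 1 = ⊤ := by
  have h := Ordinal.limitRecOn_add_one (motive := fun _ => Subgroup G) 0 ⊤
    (fun β H => if β = 0 then ⊤ else ⁅H, (⊤ : Subgroup G)⁆)
    (fun α _ H => ⨅ (β : Ordinal.{u}) (h : β < α), H β h)
  rw [zero_add, if_pos rfl] at h
  exact h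

theorem transLowerCentral_add_one.{u} (G : Type u) [Group G] (α : Ordinal.{u}) (hα : 1 ≤ α) :
    transLowerCentral G (α + 1) = ⁅transLowerCentral G α, (⊤ : Subgroup G)⁆ := by
  have h : α ≠ 0 := Order.one_le_iff_ne_zero.mp hα
  rw [transLowerCentral, Ordinal.limitRecOn_add_one, if_neg h, transLowerCentral]

theorem transLowerCentral_limit.{u} (G : Type u) [Group G] (α : Ordinal.{u})
    (hα : Order.IsSuccLimit α) :
    transLowerCentral G α = ⨅ (β : Ordinal.{u}) (_ : β < α), transLowerCentral G β := by
  rw [transLowerCentral, Ordinal.limitRecOn_limit _ _ _ _ hα]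
  rfl

/-- The lower central series of `G` has length `l`: `l` is the smallest ordinal `α ≥ 1` such that
`γ_α(G) = γ_{α+1}(G)`. -/
def HasLowerCentralLength.{u} (G : Type u) [Group G] (l : Ordinal.{u}) : Prop :=
  IsLeast {α : Ordinal.{u} | 1 ≤ α ∧ transLowerCentral G α = transLowerCentral G (α + 1)} l

/-- The endomorphism `φ̄` that an automorphism `φ` of the free group `F_n` induces on the
abelianization of `F_n` (in Mathlib, `FreeAbelianGroup (Fin n)` is by definition the abelianization
of `FreeGroup (Fin n)`, written additively). -/
noncomputable def inducedAb {n : ℕ} (φ : MulAut (FreeGroup (Fin n))) :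
    FreeAbelianGroup (Fin n) →ₗ[ℤ] FreeAbelianGroup (Fin n) :=
  AddMonoidHom.toIntLinearMap
    (MonoidHom.toAdditive (Abelianization.map φ.toMonoidHom) :
      Additive (Abelianization (FreeGroup (Fin n))) →+
        Additive (Abelianization (FreeGroup (Fin n))))

/-- The integer matrix `[φ̄]` of the induced automorphism, in the basis of the abelianization given
by the images of the free generators. -/
noncomputable def inducedMatrix {n : ℕ} (φ : MulAut (FreeGroup (Fin n))) :
    Matrix (Fin n) (Fin n) ℤ :=
  LinearMap.toMatrix (FreeAbelianGroup.basis (Fin n)) (FreeAbelianGroup.basis (Fin n))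
    (inducedAb φ)

/-- The semidirect product `F_n ⋊_φ ℤ`, where `ℤ = ⟨t⟩` and `t⁻¹ w t = φ(w)` for `w ∈ F_n`.
In Mathlib's semidirect product `w ↦ t w t⁻¹` is the action of `t`, so `t` has to act by `φ⁻¹`. -/
abbrev FreeByZ {n : ℕ} (φ : MulAut (FreeGroup (Fin n))) : Type :=
  FreeGroup (Fin n) ⋊[zpowersHom (MulAut (FreeGroup (Fin n))) φ⁻¹] Multiplicative ℤ

/-- The free generators of `F_n` as elements of `F_n ⋊_φ ℤ`. -/
def FreeByZ.gen {n : ℕ} (φ : MulAut (FreeGroup (Fin n))) (i : Fin n) : FreeByZ φ :=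
  SemidirectProduct.inl (FreeGroup.of i)

/-- The generator `t` of `ℤ` as an element of `F_n ⋊_φ ℤ`. -/
def FreeByZ.t {n : ℕ} (φ : MulAut (FreeGroup (Fin n))) : FreeByZ φ :=
  SemidirectProduct.inr (Multiplicative.ofAdd 1)

theorem FreeByZ.conj_t {n : ℕ} (φ : MulAut (FreeGroup (Fin n))) (w : FreeGroup (Fin n)) :
    (FreeByZ.t φ)⁻¹ * SemidirectProduct.inl w * FreeByZ.t φ = SemidirectProduct.inl (φ w) := by
  ext <;> simp [FreeByZ.t]

/-! Write `F` for the free group, `λ, μ` for the eigenvalues of the induced matrix, so `λμ = -1` and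
`λ + μ = s` is the trace. The subgroup `γ_{ωk}` is trapped between the derived series of `F` and the
dimension subgroups of `F`.

Lower bound. Suppose a normal `N` contains `c = [x,y]` and all `m`-th powers from `F`, with `m` odd.
In `G/[N,G]` the image of `c` is central and fixed by `φ`, while `φ` raises it to the power `det =
-1`; so `c² = 1`. As `x^m` is central too, `c^m = 1`, hence `c = 1`. The image of `F` is then
abelian, and Cayley–Hamilton puts all `(m s)`-th powers in `[N,G]`. Induction gives `c ∈ γ_n` for
every finite `n` (`genCommutator_mem_omega0`). Since `[γ_ω, γ_α] ≤ γ_{α+ω}`, the `k`-th derived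
subgroup of `F` lies in `γ_{ωk}` for `k ≥ 1`, and `F` is not solvable.

Upper bound. Expand elements of `F` as noncommutative power series in variables diagonalising `φ`.
On the coefficient of a word in leading degree, `φ` acts by a product `χ = λ^i μ^j`, and a
commutator with an element of `G` multiplies that coefficient by some `1 - χ^n`, a multiple of `χ -
1` in `R = ℤ[λ]`. The norm of `χ - 1` is never `±1` (`not_isUnit_norm`), so nothing nonzero in `R`
is divisible by all powers of `χ - 1`. Thus each block of `ω` steps kills the leading degree
(`transLowerCentral_add_omega0_le`). The powers of the augmentation ideal separate the elements of
`F` (`eq_one_of_forall_mem_augmentation_pow`), so `γ_{ω²} = 1`. -/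

/-! ### Generalities on the transfinite lower central series. -/

open Subgroup in
theorem transLowerCentral_normal.{u} (G : Type u) [Group G] (α : Ordinal.{u}) :
    (transLowerCentral G α).Normal := by
  induction α using Ordinal.limitRecOn with
  | zero => rw [transLowerCentral_zero]; infer_instance
  | add_one α ih =>
    rcases eq_or_ne α 0 with rfl | h
    · rw [zero_add, transLowerCentral_one]; infer_instance
    · rw [transLowerCentral_add_one G α (Order.one_le_iff_ne_zero.mpr h)]; infer_instance
  | limit α hα ih =>
    rw [transLowerCentral_limit G α hα]
    exact normal_iInf_normal fun β => normal_iInf_normal fun h => ih β h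

theorem transLowerCentral_add_one_le.{u} (G : Type u) [Group G] (α : Ordinal.{u}) :
    transLowerCentral G (α + 1) ≤ transLowerCentral G α := by
  rcases eq_or_ne α 0 with rfl | h
  · rw [transLowerCentral_zero]; exact le_top
  · rw [transLowerCentral_add_one G α (Order.one_le_iff_ne_zero.mpr h)]
    have := transLowerCentral_normal G α
    exact Subgroup.commutator_le_left _ _

theorem transLowerCentral_antitone.{u} (G : Type u) [Group G] :
    Antitone (transLowerCentral G) := by
  intro α β
  induction β using Ordinal.limitRecOn with
  | zero => intro h; rw [nonpos_iff_eq_zero.mp h]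
  | add_one β ih =>
    intro h
    rcases h.lt_or_eq with h | rfl
    · exact (transLowerCentral_add_one_le G β).trans (ih (Order.lt_add_one_iff.mp h))
    · exact le_rfl
  | limit β hβ ih =>
    intro h
    rcases h.lt_or_eq with h | rfl
    · rw [transLowerCentral_limit G β hβ]
      exact iInf₂_le α h
    · exact le_rfl

/-- A form of the three subgroups lemma relative to a normal subgroup. -/
theorem Subgroup.commutator_commutator_le_of_rotate {G : Type*} [Group G] (H₁ H₂ H₃ N : Subgroup G)
    [N.Normal] (h1 : ⁅⁅H₂, H₃⁆, H₁⁆ ≤ N) (h2 : ⁅⁅H₃, H₁⁆, H₂⁆ ≤ N) : ⁅⁅H₁, H₂⁆, H₃⁆ ≤ N := by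
  have key (K : Subgroup G) : K ≤ N ↔ K.map (QuotientGroup.mk' N) = ⊥ := by
    rw [Subgroup.map_eq_bot_iff, QuotientGroup.ker_mk']
  rw [key, Subgroup.map_commutator, Subgroup.map_commutator] at h1 h2 ⊢
  exact Subgroup.commutator_commutator_eq_bot_of_rotate h1 h2

/-- Induction on the finite index with the three subgroups lemma. Ordinal addition is not
commutative, so the finite index has to stand on the right. -/
theorem commutator_transLowerCentral_natCast_le.{u} (G : Type u) [Group G] (n : ℕ) :
    ∀ α : Ordinal.{u}, 1 ≤ α →
      ⁅transLowerCentral G ((n + 1 : ℕ) : Ordinal.{u}), transLowerCentral G α⁆ ≤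
        transLowerCentral G (α + (n + 1 : ℕ)) := by
  induction n with
  | zero =>
    intro α hα
    rw [zero_add, Nat.cast_one, transLowerCentral_one, transLowerCentral_add_one G α hα,
      Subgroup.commutator_comm]
  | succ n ih =>
    intro α hα
    have h1 : (1 : Ordinal) ≤ ((n + 1 : ℕ) : Ordinal) := by
      exact_mod_cast Nat.le_add_left 1 n
    have hN := transLowerCentral_normal G (α + ((n + 1 + 1 : ℕ) : Ordinal))
    rw [Nat.cast_succ (n + 1), transLowerCentral_add_one G _ h1]
    rw [Nat.cast_succ (n + 1)] at hN
    refine Subgroup.commutator_commutator_le_of_rotate _ _ _ _ ?_ ?_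
    · rw [Subgroup.commutator_comm ⊤, ← transLowerCentral_add_one G α hα,
        Subgroup.commutator_comm]
      refine (ih (α + 1) (hα.trans le_self_add)).trans (le_of_eq ?_)
      rw [add_assoc]
      congr 2
      exact_mod_cast add_comm 1 (n + 1)
    · rw [← add_assoc, transLowerCentral_add_one G _ (hα.trans le_self_add)]
      refine Subgroup.commutator_mono ?_ le_rfl
      rw [Subgroup.commutator_comm]
      exact ih α hα

theorem commutator_transLowerCentral_omega0_le.{u} (G : Type u) [Group G] (α : Ordinal.{u})
    (hα : 1 ≤ α) :
    ⁅transLowerCentral G Ordinal.omega0, transLowerCentral G α⁆ ≤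
      transLowerCentral G (α + Ordinal.omega0) := by
  rw [transLowerCentral_limit G _ (Ordinal.isSuccLimit_add α Ordinal.isSuccLimit_omega0)]
  refine le_iInf₂ fun β hβ => ?_
  obtain ⟨d, hd, hβd⟩ := (Ordinal.lt_add_iff Ordinal.omega0_ne_zero).mp hβ
  obtain ⟨n, rfl⟩ := Ordinal.lt_omega0.mp hd
  refine le_trans ?_ ((commutator_transLowerCentral_natCast_le G n α hα).trans
    (transLowerCentral_antitone G (hβd.trans ?_)))
  · exact Subgroup.commutator_mono
      (transLowerCentral_antitone G (Ordinal.natCast_lt_omega0 _).le) le_rfl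
  · gcongr; exact n.le_succ

theorem transLowerCentral_eq_of_stable.{u} (G : Type u) [Group G] (α : Ordinal.{u}) (hα : 1 ≤ α)
    (h : transLowerCentral G α = transLowerCentral G (α + 1)) (β : Ordinal.{u}) (hβ : α ≤ β) :
    transLowerCentral G β = transLowerCentral G α := by
  induction β using Ordinal.limitRecOn with
  | zero => rw [nonpos_iff_eq_zero.mp hβ]
  | add_one β ih =>
    rcases hβ.lt_or_eq with hβ | rfl
    · have hβ := Order.lt_add_one_iff.mp hβ
      rw [transLowerCentral_add_one G β (hα.trans hβ), ih hβ,
        ← transLowerCentral_add_one G α hα, ← h]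
    · rfl
  | limit β hlim ih =>
    refine le_antisymm (transLowerCentral_antitone G hβ) ?_
    rw [transLowerCentral_limit G β hlim]
    refine le_iInf₂ fun δ hδ => ?_
    rcases le_total α δ with h' | h'
    · exact (ih δ hδ h').ge
    · exact transLowerCentral_antitone G h'

/-- If `γ_{ω k}` is nontrivial for all `k` while `γ_{ω²}` is trivial, the length is `ω²`. -/
theorem hasLowerCentralLength_omega0_sq.{u} (G : Type u) [Group G]
    (hne : ∀ k : ℕ, transLowerCentral G (Ordinal.omega0 * k) ≠ ⊥)
    (hbot : transLowerCentral G (Ordinal.omega0 ^ 2) = ⊥) :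
    HasLowerCentralLength G (Ordinal.omega0 ^ 2) := by
  refine ⟨⟨Order.one_le_iff_ne_zero.mpr (pow_ne_zero 2 Ordinal.omega0_ne_zero), ?_⟩, ?_⟩
  · exact le_antisymm (hbot ▸ bot_le) (transLowerCentral_add_one_le G _)
  · rintro α ⟨hα, h⟩
    -- An ordinal below `ω²` lies below some `ω k`; stability there would make `γ_{ωk}` equal to the
    -- trivial `γ_{ω²}`.
    by_contra! hlt
    rw [sq, Ordinal.lt_mul_iff_of_isSuccLimit Ordinal.isSuccLimit_omega0] at hlt
    obtain ⟨d, hd, hlt⟩ := hlt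
    obtain ⟨k, rfl⟩ := Ordinal.lt_omega0.mp hd
    apply hne k
    rw [transLowerCentral_eq_of_stable G α hα h _ hlt.le, ← hbot]
    refine (transLowerCentral_eq_of_stable G α hα h _ (hlt.le.trans ?_)).symm
    rw [sq]
    gcongr

theorem transLowerCentral_omega0_sq_le.{u} (G : Type u) [Group G] (k : ℕ) :
    transLowerCentral G (Ordinal.omega0 ^ 2) ≤ transLowerCentral G (Ordinal.omega0 * k) := by
  refine transLowerCentral_antitone G ?_
  rw [sq]
  gcongr
  exact (Ordinal.natCast_lt_omega0 k).le

/-! ### Exponent sums and two-generator quotients that are abelian or of Heisenberg type. -/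

/-- The exponent sum of the `i`-th free generator. -/
def expSum (i : Fin 2) (g : FreeGroup (Fin 2)) : ℤ :=
  (FreeGroup.lift (fun j => Multiplicative.ofAdd (if j = i then (1 : ℤ) else 0)) g).toAdd

@[simp] theorem expSum_one (i : Fin 2) : expSum i 1 = 0 := by simp [expSum]

@[simp] theorem expSum_mul (i : Fin 2) (g h : FreeGroup (Fin 2)) :
    expSum i (g * h) = expSum i g + expSum i h := by simp [expSum]

@[simp] theorem expSum_inv (i : Fin 2) (g : FreeGroup (Fin 2)) :
    expSum i g⁻¹ = -expSum i g := by simp [expSum]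

@[simp] theorem expSum_of (i j : Fin 2) : expSum i (FreeGroup.of j) = if j = i then 1 else 0 := by
  simp [expSum]

@[simp] theorem expSum_pow (i : Fin 2) (g : FreeGroup (Fin 2)) (n : ℕ) :
    expSum i (g ^ n) = n * expSum i g := by simp [expSum]

@[simp] theorem expSum_zpow (i : Fin 2) (g : FreeGroup (Fin 2)) (n : ℤ) :
    expSum i (g ^ n) = n * expSum i g := by simp [expSum]

/-- The bridge that allows the entries of `inducedMatrix` to be computed as exponent sums. -/
theorem toFinsupp_abelianization (i : Fin 2) (g : FreeGroup (Fin 2)) :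
    FreeAbelianGroup.toFinsupp (Additive.ofMul (Abelianization.of g) : FreeAbelianGroup (Fin 2)) i
      = expSum i g := by
  induction g using FreeGroup.induction_on with
  | C1 => simp; rfl
  | of j =>
    have : (Additive.ofMul (Abelianization.of (FreeGroup.of j)) : FreeAbelianGroup (Fin 2))
      = FreeAbelianGroup.of j := rfl
    rw [this]
    simp [Finsupp.single_apply]
  | inv_of j h =>
    rw [map_inv, ofMul_inv, expSum_inv, ← h]
    exact DFunLike.congr_fun (map_neg (FreeAbelianGroup.toFinsupp (X := Fin 2)) _) i
  | mul g h hg hh =>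
    rw [map_mul, ofMul_mul, expSum_mul, ← hg, ← hh]
    exact DFunLike.congr_fun (map_add (FreeAbelianGroup.toFinsupp (X := Fin 2)) _ _) i

theorem inducedMatrix_apply (φ : MulAut (FreeGroup (Fin 2))) (i j : Fin 2) :
    inducedMatrix φ i j = expSum i (φ (FreeGroup.of j)) := by
  rw [inducedMatrix, LinearMap.toMatrix_apply, ← toFinsupp_abelianization]
  have h : FreeAbelianGroup.basis (Fin 2) j = FreeAbelianGroup.of j := by
    simp [FreeAbelianGroup.basis, FreeAbelianGroup.equivFinsupp]
  rw [h]
  rfl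

theorem expSum_map (φ : MulAut (FreeGroup (Fin 2))) (i : Fin 2) (g : FreeGroup (Fin 2)) :
    expSum i (φ g) = inducedMatrix φ i 0 * expSum 0 g + inducedMatrix φ i 1 * expSum 1 g := by
  simp only [inducedMatrix_apply]
  induction g using FreeGroup.induction_on with
  | C1 => simp
  | of j => fin_cases j <;> simp
  | inv_of j h => simp [h]; ring
  | mul g h hg hh => simp [hg, hh]; ring

/-- A map from `F₂` killing the relevant commutators up to a central element `c` behaves like the
Heisenberg group. -/
theorem map_mul_map_of_central {Q : Type*} [Group Q] (π : FreeGroup (Fin 2) →* Q) (c : Q)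
    (hc : ∀ g, Commute c (π g))
    (hxy : π (FreeGroup.of 0) * π (FreeGroup.of 1) =
      π (FreeGroup.of 1) * π (FreeGroup.of 0) * c) (g h : FreeGroup (Fin 2)) :
    π g * π h = π h * π g * c ^ (expSum 0 g * expSum 1 h - expSum 1 g * expSum 0 h) := by
  have hc' (n : ℤ) (g) : c ^ n * π g = π g * c ^ n := ((hc g).zpow_left n).eq
  have step_mul (g h₁ h₂ : FreeGroup (Fin 2)) (m n : ℤ) (h1 : π g * π h₁ = π h₁ * π g * c ^ m)
      (h2 : π g * π h₂ = π h₂ * π g * c ^ n) :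
      π g * π (h₁ * h₂) = π (h₁ * h₂) * π g * c ^ (m + n) := by
    rw [map_mul, ← mul_assoc, h1, mul_assoc, hc', ← mul_assoc, mul_assoc (π h₁), h2, add_comm,
      zpow_add]
    simp only [mul_assoc]
  have step_inv (g h : FreeGroup (Fin 2)) (m : ℤ) (h1 : π g * π h = π h * π g * c ^ m) :
      π g * π h⁻¹ = π h⁻¹ * π g * c ^ (-m) := by
    have h2 := congrArg (fun q => (π h)⁻¹ * q * (π h)⁻¹ * c ^ (-m)) h1
    have h3 := hc' (-m) h⁻¹
    rw [map_inv] at h3 ⊢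
    simp only [mul_assoc, inv_mul_cancel_left, mul_inv_cancel_left] at h2
    rw [← h3, zpow_neg, ← mul_assoc (c ^ m), mul_inv_cancel, one_mul] at h2
    rw [zpow_neg, mul_assoc, ← h2]
  have swap (g h : FreeGroup (Fin 2)) (m : ℤ) (h1 : π g * π h = π h * π g * c ^ m) :
      π h * π g = π g * π h * c ^ (-m) := by
    rw [h1, mul_assoc, ← zpow_add, add_neg_cancel, zpow_zero, mul_one]
  -- Bilinearity one slot at a time: the first argument is a generator here, and the final induction
  -- treats the first slot by swapping the roles of the arguments.
  have key (j : Fin 2) (h : FreeGroup (Fin 2)) : π (FreeGroup.of j) * π h =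
      π h * π (FreeGroup.of j) *
        c ^ (expSum 0 (FreeGroup.of j) * expSum 1 h - expSum 1 (FreeGroup.of j) * expSum 0 h) := by
    have base (k : Fin 2) : π (FreeGroup.of j) * π (FreeGroup.of k) =
      π (FreeGroup.of k) * π (FreeGroup.of j) *
        c ^ (expSum 0 (FreeGroup.of j) * expSum 1 (FreeGroup.of k) -
          expSum 1 (FreeGroup.of j) * expSum 0 (FreeGroup.of k)) := by
      fin_cases j <;> fin_cases k
      · simp
      · simpa using hxy
      · have := swap _ _ 1 (by simpa using hxy)
        simpa using this
      · simp
    induction h using FreeGroup.induction_on with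
    | C1 => simp
    | of k => exact base k
    | inv_of k h =>
      convert step_inv _ _ _ h using 2
      congr 1; simp only [expSum_inv]; ring
    | mul h₁ h₂ ih₁ ih₂ =>
      convert step_mul _ _ _ _ _ ih₁ ih₂ using 2
      congr 1; simp only [expSum_mul]; ring
  induction g using FreeGroup.induction_on with
  | C1 => simp
  | of j => exact key j h
  | inv_of j ih =>
    have := swap _ _ _ (step_inv _ _ _ (swap _ _ _ ih))
    convert this using 2
    congr 1; simp only [expSum_inv]; ring
  | mul g₁ g₂ ih₁ ih₂ =>
    have := swap _ _ _ (step_mul _ _ _ _ _ (swap _ _ _ ih₁) (swap _ _ _ ih₂))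
    convert this using 2
    congr 1; simp only [expSum_mul]; ring

theorem map_eq_of_commute {Q : Type*} [Group Q] (π : FreeGroup (Fin 2) →* Q)
    (hxy : Commute (π (FreeGroup.of 0)) (π (FreeGroup.of 1))) (g : FreeGroup (Fin 2)) :
    π g = π (FreeGroup.of 0) ^ expSum 0 g * π (FreeGroup.of 1) ^ expSum 1 g := by
  induction g using FreeGroup.induction_on with
  | C1 => simp
  | of j => fin_cases j <;> simp
  | inv_of j h => fin_cases j <;> simp
  | mul g h hg hh =>
    rw [map_mul, hg, hh, expSum_mul, expSum_mul, zpow_add, zpow_add, mul_assoc, mul_assoc,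
      ← mul_assoc (π (FreeGroup.of 1) ^ expSum 1 g),
      ((hxy.symm.zpow_left (expSum 1 g)).zpow_right (expSum 0 h)).eq, mul_assoc]

theorem inducedMatrix_det (φ : MulAut (FreeGroup (Fin 2))) :
    (inducedMatrix φ).det = inducedMatrix φ 0 0 * inducedMatrix φ 1 1 -
      inducedMatrix φ 0 1 * inducedMatrix φ 1 0 := Matrix.det_fin_two _

theorem inducedMatrix_trace (φ : MulAut (FreeGroup (Fin 2))) :
    (inducedMatrix φ).trace = inducedMatrix φ 0 0 + inducedMatrix φ 1 1 := Matrix.trace_fin_two _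

/-- The commutator `x⁻¹ y⁻¹ x y` of the free generators. -/
def genCommutator : FreeGroup (Fin 2) :=
  (FreeGroup.of 0)⁻¹ * (FreeGroup.of 1)⁻¹ * FreeGroup.of 0 * FreeGroup.of 1

/-! ### One step of the series at finite level, and `[x,y] ∈ γ_ω`. -/

section Step

variable (φ : MulAut (FreeGroup (Fin 2))) (N : Subgroup (FreeByZ φ)) [N.Normal]

/-- The quotient map `F₂ → G / [N, G]`. -/
def toCommutatorQuotient :
    FreeGroup (Fin 2) →* FreeByZ φ ⧸ ⁅N, (⊤ : Subgroup (FreeByZ φ))⁆ :=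
  (QuotientGroup.mk' _).comp SemidirectProduct.inl

theorem toCommutatorQuotient_eq_one_iff (g : FreeGroup (Fin 2)) :
    toCommutatorQuotient φ N g = 1 ↔
      SemidirectProduct.inl g ∈ ⁅N, (⊤ : Subgroup (FreeByZ φ))⁆ :=
  QuotientGroup.eq_one_iff _

theorem commute_toCommutatorQuotient {g : FreeGroup (Fin 2)}
    (hg : SemidirectProduct.inl g ∈ N) (u : FreeByZ φ) :
    Commute (toCommutatorQuotient φ N g) (QuotientGroup.mk' _ u) := by
  rw [← commutatorElement_eq_one_iff_commute, toCommutatorQuotient, MonoidHom.comp_apply,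
    ← map_commutatorElement]
  exact (QuotientGroup.eq_one_iff _).mpr (Subgroup.commutator_mem_commutator hg trivial)

theorem toCommutatorQuotient_map (g : FreeGroup (Fin 2)) :
    toCommutatorQuotient φ N (φ g) =
      (QuotientGroup.mk' _ (FreeByZ.t φ))⁻¹ * toCommutatorQuotient φ N g *
        QuotientGroup.mk' _ (FreeByZ.t φ) := by
  simp only [toCommutatorQuotient, MonoidHom.comp_apply]
  rw [← FreeByZ.conj_t, map_mul, map_mul]
  rfl

theorem toCommutatorQuotient_map_of_mem {g : FreeGroup (Fin 2)}
    (hg : SemidirectProduct.inl g ∈ N) :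
    toCommutatorQuotient φ N (φ g) = toCommutatorQuotient φ N g := by
  rw [toCommutatorQuotient_map, mul_assoc, (commute_toCommutatorQuotient φ N hg _).eq,
    inv_mul_cancel_left]

/-- Modulo `[N,G]` the commutator is central, hence fixed by `φ`; but `φ` raises it to the power
`det = -1`, so its square is trivial. Centrality of `x^m` makes its `m`-th power trivial, and `m` is
odd. -/
theorem genCommutator_mem_step (hdet : (inducedMatrix φ).det = -1) {m : ℤ} (hm : Odd m)
    (hc : SemidirectProduct.inl genCommutator ∈ N)
    (hx : SemidirectProduct.inl (FreeGroup.of 0 ^ m) ∈ N) :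
    SemidirectProduct.inl genCommutator ∈ ⁅N, (⊤ : Subgroup (FreeByZ φ))⁆ := by
  rw [← toCommutatorQuotient_eq_one_iff]
  set π := toCommutatorQuotient φ N with hπ
  have key := map_mul_map_of_central π (π genCommutator)
    (fun g => commute_toCommutatorQuotient φ N hc _) (by
      simp only [genCommutator, map_mul, map_inv]; group)
  have h1 : π genCommutator = π genCommutator ^ (-1 : ℤ) := by
    conv_lhs => rw [hπ, ← toCommutatorQuotient_map_of_mem φ N hc, ← hπ]
    have := key (φ (FreeGroup.of 0)) (φ (FreeGroup.of 1))
    simp only [← inducedMatrix_apply] at this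
    rw [inducedMatrix_det] at hdet
    rw [show inducedMatrix φ 0 0 * inducedMatrix φ 1 1 - inducedMatrix φ 1 0 * inducedMatrix φ 0 1
      = -1 by linear_combination hdet] at this
    simp only [genCommutator, map_mul, map_inv] at this ⊢
    rw [mul_assoc, this]
    group
  have h2 : π genCommutator ^ m = 1 := by
    have h := key (FreeGroup.of 0 ^ m) (FreeGroup.of 1)
    have hcx : π (FreeGroup.of 0 ^ m) * π (FreeGroup.of 1) =
        π (FreeGroup.of 1) * π (FreeGroup.of 0 ^ m) := commute_toCommutatorQuotient φ N hx _
    rw [hcx] at h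
    simpa using h
  obtain ⟨k, rfl⟩ := hm
  have h3 : π genCommutator ^ (2 : ℤ) = 1 := by
    rw [zpow_two]; nth_rw 1 [h1]; simp
  rw [zpow_add, zpow_mul, h3, one_zpow, one_mul, zpow_one] at h2
  exact h2

/-- By `hc` the image of `F₂` is abelian, so only exponent sums matter. Cayley–Hamilton reads
`s·φ(h) = φ²(h) - h` additively, and `φ²` fixes the image of `h^m` because `h^m ∈ N`. -/
theorem zpow_mem_step (hdet : (inducedMatrix φ).det = -1) {m : ℤ}
    (hc : SemidirectProduct.inl genCommutator ∈ ⁅N, (⊤ : Subgroup (FreeByZ φ))⁆)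
    (hN : ∀ g, SemidirectProduct.inl (g ^ m) ∈ N) (g : FreeGroup (Fin 2)) :
    SemidirectProduct.inl (g ^ (m * (inducedMatrix φ).trace)) ∈
      ⁅N, (⊤ : Subgroup (FreeByZ φ))⁆ := by
  rw [← toCommutatorQuotient_eq_one_iff] at hc ⊢
  set π := toCommutatorQuotient φ N with hπ
  have hcomm : Commute (π (FreeGroup.of 0)) (π (FreeGroup.of 1)) := by
    simp only [genCommutator, map_mul, map_inv] at hc
    rw [mul_assoc, mul_eq_one_iff_inv_eq, mul_inv_rev, inv_inv, inv_inv] at hc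
    exact hc.symm
  obtain ⟨h, rfl⟩ := φ.surjective g
  have h1 : π (φ (φ (h ^ m)) * (h ^ m)⁻¹) = 1 := by
    rw [map_mul, map_inv π, mul_inv_eq_one, hπ, toCommutatorQuotient_map,
      toCommutatorQuotient_map_of_mem φ N (hN h), ← toCommutatorQuotient_map,
      toCommutatorQuotient_map_of_mem φ N (hN h)]
  rw [← h1, map_eq_of_commute π hcomm, map_eq_of_commute π hcomm (_ * _)]
  rw [inducedMatrix_det] at hdet
  have e0 : expSum 0 (φ h ^ (m * (inducedMatrix φ).trace)) =
      expSum 0 (φ (φ (h ^ m)) * (h ^ m)⁻¹) := by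
    simp only [expSum_mul, expSum_inv, expSum_map, expSum_zpow, inducedMatrix_trace]
    linear_combination (m * expSum 0 h) * hdet
  have e1 : expSum 1 (φ h ^ (m * (inducedMatrix φ).trace)) =
      expSum 1 (φ (φ (h ^ m)) * (h ^ m)⁻¹) := by
    simp only [expSum_mul, expSum_inv, expSum_map, expSum_zpow, inducedMatrix_trace]
    linear_combination (m * expSum 1 h) * hdet
  rw [e0, e1]

end Step

/-- The two claims need each other: odd powers in `γ_{n+1}` push the commutator one step down, which
then pushes the powers down at the cost of a factor `s`. -/
theorem genCommutator_mem_natCast (φ : MulAut (FreeGroup (Fin 2)))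
    (hdet : (inducedMatrix φ).det = -1) (hodd : Odd (inducedMatrix φ).trace) (n : ℕ) :
    SemidirectProduct.inl genCommutator ∈ transLowerCentral (FreeByZ φ) ((n + 1 : ℕ)) ∧
      ∀ g, SemidirectProduct.inl (g ^ ((inducedMatrix φ).trace ^ n)) ∈
        transLowerCentral (FreeByZ φ) ((n + 1 : ℕ)) := by
  induction n with
  | zero => simp [transLowerCentral_one]
  | succ n ih =>
    have h1 : (1 : Ordinal) ≤ ((n + 1 : ℕ) : Ordinal) := by exact_mod_cast Nat.le_add_left 1 n
    have := transLowerCentral_normal (FreeByZ φ) ((n + 1 : ℕ) : Ordinal)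
    rw [Nat.cast_succ (n + 1), transLowerCentral_add_one _ _ h1, pow_succ]
    have hc := genCommutator_mem_step φ _ hdet (hodd.pow (n := n)) ih.1 (ih.2 _)
    exact ⟨hc, zpow_mem_step φ _ hdet hc ih.2⟩

theorem genCommutator_mem_omega0 (φ : MulAut (FreeGroup (Fin 2)))
    (hdet : (inducedMatrix φ).det = -1) (hodd : Odd (inducedMatrix φ).trace) :
    SemidirectProduct.inl genCommutator ∈ transLowerCentral (FreeByZ φ) Ordinal.omega0 := by
  rw [transLowerCentral_limit _ _ Ordinal.isSuccLimit_omega0]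
  simp only [Subgroup.mem_iInf]
  intro β hβ
  obtain ⟨n, rfl⟩ := Ordinal.lt_omega0.mp hβ
  refine transLowerCentral_antitone _ ?_ (genCommutator_mem_natCast φ hdet hodd n).1
  exact_mod_cast n.le_succ

/-! ### Nontriviality of `γ_{ωk}` through the derived series. -/

/-- A normal subgroup of `F₂` containing the commutator of the generators contains the derived
subgroup. -/
theorem commutator_le_of_genCommutator_mem (N : Subgroup (FreeGroup (Fin 2))) [N.Normal]
    (h : genCommutator ∈ N) : commutator (FreeGroup (Fin 2)) ≤ N := by
  have hcomm : Commute (QuotientGroup.mk' N (FreeGroup.of 0))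
      (QuotientGroup.mk' N (FreeGroup.of 1)) := by
    have hc : QuotientGroup.mk' N genCommutator = 1 := (QuotientGroup.eq_one_iff _).mpr h
    simp only [genCommutator, map_mul, map_inv] at hc
    rw [mul_assoc, mul_eq_one_iff_inv_eq, mul_inv_rev, inv_inv, inv_inv] at hc
    exact hc.symm
  rw [commutator_def, Subgroup.commutator_le]
  intro g _ u _
  rw [← QuotientGroup.ker_mk' N, MonoidHom.mem_ker, map_eq_of_commute _ hcomm]
  simp [commutatorElement_def]

/-- The derived subgroup lies in `γ_ω`, so each further derived step is contained in `[γ_ω, γ_{ωk}]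
≤ γ_{ωk+ω}`. -/
theorem derivedSeries_le_comap (φ : MulAut (FreeGroup (Fin 2)))
    (hdet : (inducedMatrix φ).det = -1) (hodd : Odd (inducedMatrix φ).trace) (k : ℕ) :
    derivedSeries (FreeGroup (Fin 2)) (k + 1) ≤
      (transLowerCentral (FreeByZ φ) (Ordinal.omega0 * (k + 1 : ℕ))).comap
        SemidirectProduct.inl := by
  have hω : derivedSeries (FreeGroup (Fin 2)) 1 ≤
      (transLowerCentral (FreeByZ φ) Ordinal.omega0).comap SemidirectProduct.inl := by
    have := transLowerCentral_normal (FreeByZ φ) Ordinal.omega0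
    rw [derivedSeries_one]
    exact commutator_le_of_genCommutator_mem _ (genCommutator_mem_omega0 φ hdet hodd)
  induction k with
  | zero => simpa using hω
  | succ k ih =>
    rw [derivedSeries_succ, Nat.cast_succ (k + 1), mul_add_one, ← Subgroup.map_le_iff_le_comap,
      Subgroup.map_commutator]
    refine le_trans ?_ (commutator_transLowerCentral_omega0_le _ _ ?_)
    · refine Subgroup.commutator_mono ?_ (Subgroup.map_le_iff_le_comap.mpr ih)
      exact Subgroup.map_le_iff_le_comap.mpr
        ((derivedSeries_antitone _ (Nat.le_add_left 1 k)).trans hω)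
    · rw [Order.one_le_iff_ne_zero]
      exact mul_ne_zero Ordinal.omega0_ne_zero (by exact_mod_cast k.succ_ne_zero)

/-- A 5-cycle and an adjacent transposition generate the non-solvable group `S₅`. -/
theorem not_isSolvable_freeGroup : ¬ Group.IsSolvable (FreeGroup (Fin 2)) := by
  intro h
  refine Equiv.Perm.not_isSolvable_fin_5 (Group.isSolvable_of_surjective
    (f := FreeGroup.lift ![finRotate 5, Equiv.swap 0 1]) ?_)
  rw [← MonoidHom.range_eq_top, FreeGroup.range_lift_eq_closure]
  have := Equiv.Perm.closure_cycle_adjacent_swap (isCycle_finRotate (n := 3))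
    (support_finRotate (n := 3)) 0
  convert this using 2
  rw [Matrix.range_cons, Matrix.range_cons, Matrix.range_empty, Set.union_empty]
  rfl

theorem transLowerCentral_omega0_mul_ne_bot (φ : MulAut (FreeGroup (Fin 2)))
    (hdet : (inducedMatrix φ).det = -1) (hodd : Odd (inducedMatrix φ).trace) (k : ℕ) :
    transLowerCentral (FreeByZ φ) (Ordinal.omega0 * k) ≠ ⊥ := by
  intro hbot
  have hbot' : transLowerCentral (FreeByZ φ) (Ordinal.omega0 * (k + 1 : ℕ)) = ⊥ := by
    rw [eq_bot_iff, ← hbot]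
    refine transLowerCentral_antitone _ ?_
    gcongr
    exact k.le_succ
  refine not_isSolvable_freeGroup ⟨⟨k + 1, ?_⟩⟩
  rw [eq_bot_iff]
  refine (derivedSeries_le_comap φ hdet hodd k).trans ?_
  rw [hbot', MonoidHom.comap_bot, (MonoidHom.ker_eq_bot_iff _).mpr SemidirectProduct.inl_injective]

/-! ### A faithful matrix representation of `F₂` by ping-pong. -/

/-- Invertible matrices act on nonzero vectors. -/
abbrev nonzeroVectorAction :
    MulAction (Matrix (Fin 2) (Fin 2) ℝ)ˣ {v : Fin 2 → ℝ // v ≠ 0} where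
  smul M v := ⟨M.1.mulVec v.1, fun h => v.2 (by
    have := congrArg (M⁻¹.1.mulVec ·) h
    simpa only [Matrix.mulVec_mulVec, ← Units.val_mul, inv_mul_cancel, Units.val_one,
      Matrix.one_mulVec, Matrix.mulVec_zero] using this)⟩
  one_smul v := Subtype.ext (Matrix.one_mulVec v.1)
  mul_smul M N v := Subtype.ext (Matrix.mulVec_mulVec v.1 M.1 N.1).symm

/-- The elementary matrices with parameter `r` as images of the two free generators. -/
def elementaryUnit {R : Type*} [CommRing R] (r : R) : Fin 2 → (Matrix (Fin 2) (Fin 2) R)ˣ :=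
  ![⟨!![1, r; 0, 1], !![1, -r; 0, 1], by simp [Matrix.one_fin_two],
      by simp [Matrix.one_fin_two]⟩,
    ⟨!![1, 0; r, 1], !![1, 0; -r, 1], by simp [Matrix.one_fin_two],
      by simp [Matrix.one_fin_two]⟩]

theorem sq_pos_of_sq_le {a b : ℝ} (hab : a ≠ 0 ∨ b ≠ 0) (h : a ^ 2 ≤ b ^ 2) : 0 < b ^ 2 := by
  rcases hab with ha | hb
  · exact (sq_pos_of_ne_zero ha).trans_le h
  · exact sq_pos_of_ne_zero hb

/-- The parameter 3 keeps the inequality strict when `|a| = |b|`: for `|a| ≤ |b|` one has `|a + 3b|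
≥ 2|b|`, whereas 2 would only give `|b|`. -/
theorem ping {a b : ℝ} (hab : a ≠ 0 ∨ b ≠ 0) (h : ¬ (|b| < |a| ∧ a * b < 0)) :
    |b| < |a + 3 * b| ∧ 0 ≤ (a + 3 * b) * b := by
  rw [← sq_lt_sq] at h ⊢
  rcases lt_or_ge (b ^ 2) (a ^ 2) with h1 | h1
  · have h2 : 0 ≤ a * b := not_lt.mp fun h2 => h ⟨h1, h2⟩
    constructor <;> nlinarith [sq_nonneg b]
  · have hb : 0 < b ^ 2 := sq_pos_of_sq_le hab h1
    have h3 := sq_nonneg (a + b)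
    constructor <;> nlinarith

theorem pong {a b : ℝ} (hab : a ≠ 0 ∨ b ≠ 0) (h : ¬ (|b| < |a| ∧ 0 ≤ a * b)) :
    |b| < |a - 3 * b| ∧ (a - 3 * b) * b < 0 := by
  rw [← sq_lt_sq] at h ⊢
  rcases lt_or_ge (b ^ 2) (a ^ 2) with h1 | h1
  · have h2 : a * b < 0 := not_le.mp fun h2 => h ⟨h1, h2⟩
    constructor <;> nlinarith [sq_nonneg b]
  · have hb : 0 < b ^ 2 := sq_pos_of_sq_le hab h1
    have h3 := sq_nonneg (a - b)
    constructor <;> nlinarith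

theorem nonzero_fin_two {v : Fin 2 → ℝ} (hv : v ≠ 0) : v 0 ≠ 0 ∨ v 1 ≠ 0 := by
  by_contra! h
  exact hv (by ext i; fin_cases i <;> simp [h.1, h.2])

theorem injective_lift_elementaryUnit_three :
    Function.Injective (FreeGroup.lift (elementaryUnit (3 : ℝ))) := by
  let _ := nonzeroVectorAction
  -- The cone where coordinate `i` dominates is split by the sign of the product of the coordinates:
  -- `X i` attracts the `i`-th generator and `Y i` its inverse.
  let X : Fin 2 → Set {v : Fin 2 → ℝ // v ≠ 0} :=
    ![{v | |v.1 1| < |v.1 0| ∧ 0 ≤ v.1 0 * v.1 1}, {v | |v.1 0| < |v.1 1| ∧ 0 ≤ v.1 1 * v.1 0}]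
  let Y : Fin 2 → Set {v : Fin 2 → ℝ // v ≠ 0} :=
    ![{v | |v.1 1| < |v.1 0| ∧ v.1 0 * v.1 1 < 0}, {v | |v.1 0| < |v.1 1| ∧ v.1 1 * v.1 0 < 0}]
  have smul_val (M : (Matrix (Fin 2) (Fin 2) ℝ)ˣ) (v : {v : Fin 2 → ℝ // v ≠ 0}) :
    (M • v).1 = M.1.mulVec v.1 := rfl
  refine FreeGroup.injective_lift_of_ping_pong _ X Y ?_ ?_ ?_ ?_ ?_ ?_
  · intro i
    fin_cases i
    · exact ⟨⟨![1, 0], by simp⟩, by simp [X]⟩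
    · exact ⟨⟨![0, 1], by simp⟩, by simp [X]⟩
  · intro i j hij
    refine Set.disjoint_left.mpr fun v hv hv' => ?_
    fin_cases i <;> fin_cases j <;>
      first
      | exact hij rfl
      | exact lt_asymm hv.1 hv'.1
  · intro i j hij
    refine Set.disjoint_left.mpr fun v hv hv' => ?_
    fin_cases i <;> fin_cases j <;>
      first
      | exact hij rfl
      | exact lt_asymm hv.1 hv'.1
  · intro i j
    refine Set.disjoint_left.mpr fun v hv hv' => ?_
    fin_cases i <;> fin_cases j <;>
      first
      | exact lt_asymm hv.1 hv'.1
      | exact hv'.2.not_ge hv.2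
  · rintro i _ ⟨v, hv, rfl⟩
    fin_cases i
    · simpa [X, smul_val, elementaryUnit, Matrix.mulVec, dotProduct] using
        ping (nonzero_fin_two v.2) hv
    · simpa [X, smul_val, elementaryUnit, Matrix.mulVec, dotProduct, add_comm] using
        ping (nonzero_fin_two v.2).symm hv
  · rintro i _ ⟨v, hv, rfl⟩
    fin_cases i
    · simpa [Y, smul_val, elementaryUnit, Matrix.mulVec, dotProduct, sub_eq_add_neg] using
        pong (nonzero_fin_two v.2) hv
    · simpa [Y, smul_val, elementaryUnit, Matrix.mulVec, dotProduct, add_comm, sub_eq_add_neg]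
        using pong (nonzero_fin_two v.2).symm hv

/-- Specialising the variable at 3 recovers the faithful real representation. -/
theorem injective_lift_elementaryUnit_X :
    Function.Injective (FreeGroup.lift (elementaryUnit (Polynomial.X : Polynomial ℝ))) := by
  have h : (Units.map ((Polynomial.evalRingHom (3 : ℝ)).mapMatrix (m := Fin 2)).toMonoidHom).comp
      (FreeGroup.lift (elementaryUnit (Polynomial.X : Polynomial ℝ))) =
      FreeGroup.lift (elementaryUnit (3 : ℝ)) := by
    ext i : 2
    fin_cases i <;> ext i j <;> fin_cases i <;> fin_cases j <;> simp [elementaryUnit]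
  have h3 := injective_lift_elementaryUnit_three
  rw [← h, MonoidHom.coe_comp] at h3
  exact h3.of_comp

/-! ### Powers of the augmentation ideal and their intersection. -/

section GroupAlgebra

variable {F : Type*} [Group F]

/-- The augmentation ideal of the group algebra `ℝ[F]`, as a subspace. -/
noncomputable def augmentation (F : Type*) [Group F] : Submodule ℝ (MonoidAlgebra ℝ F) :=
  Submodule.span ℝ (Set.range fun g : F => MonoidAlgebra.of ℝ F g - 1)

theorem of_sub_one_mem_augmentation (g : F) : MonoidAlgebra.of ℝ F g - 1 ∈ augmentation F :=
  Submodule.subset_span ⟨g, rfl⟩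

theorem augmentation_mul_le : augmentation F * augmentation F ≤ augmentation F := by
  rw [augmentation, Submodule.span_mul_span, Submodule.span_le]
  rintro _ ⟨_, ⟨g, rfl⟩, _, ⟨h, rfl⟩, rfl⟩
  have : (MonoidAlgebra.of ℝ F g - 1) * (MonoidAlgebra.of ℝ F h - 1) =
      (MonoidAlgebra.of ℝ F (g * h) - 1) - (MonoidAlgebra.of ℝ F g - 1) -
        (MonoidAlgebra.of ℝ F h - 1) := by
    rw [map_mul]; noncomm_ring
  simp only [this]
  exact sub_mem (sub_mem (of_sub_one_mem_augmentation _) (of_sub_one_mem_augmentation _))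
    (of_sub_one_mem_augmentation _)

theorem augmentation_pow_succ_succ_le (k : ℕ) :
    augmentation F ^ (k + 2) ≤ augmentation F ^ (k + 1) := by
  rw [pow_succ, pow_succ, mul_assoc]
  exact mul_le_mul' le_rfl augmentation_mul_le

/-- The exponent 0 is excluded because the zeroth power of a submodule is the line of scalars, not
the whole algebra. -/
theorem augmentation_pow_antitone {m n : ℕ} (hm : 1 ≤ m) (h : m ≤ n) :
    augmentation F ^ n ≤ augmentation F ^ m := by
  induction n, h using Nat.le_induction with
  | base => exact le_rfl
  | succ n hn ih =>
    obtain ⟨k, rfl⟩ := Nat.exists_eq_add_of_le' (hm.trans hn)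
    exact (augmentation_pow_succ_succ_le k).trans ih

end GroupAlgebra

theorem exists_smul_of_mem_augmentation_pow {R S : Type*} [CommRing S] [Algebra ℝ S] [Ring R]
    [Algebra ℝ R] [Algebra S R] {F : Type*} [Group F] (z : S)
    (σ : MonoidAlgebra ℝ F →ₐ[ℝ] R)
    [IsScalarTower ℝ S R]
    (hσ : ∀ a ∈ augmentation F, ∃ b, σ a = z • b) (k : ℕ) :
    ∀ a ∈ augmentation F ^ k, ∃ b, σ a = z ^ k • b := by
  induction k with
  | zero => intro a _; exact ⟨σ a, by simp⟩
  | succ k ih =>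
    intro a ha
    rw [pow_succ] at ha
    induction ha using Submodule.mul_induction_on' with
    | mem_mul_mem p hp q hq =>
      obtain ⟨b, hb⟩ := ih p hp
      obtain ⟨c, hc⟩ := hσ q hq
      exact ⟨b * c, by rw [map_mul, hb, hc, smul_mul_smul_comm, pow_succ]⟩
    | add p hp q hq h1 h2 =>
      obtain ⟨b, hb⟩ := h1
      obtain ⟨c, hc⟩ := h2
      exact ⟨b + c, by rw [map_add, hb, hc, smul_add]⟩

/-- Over `ℝ[X]` the faithful representation is the identity modulo `X`, so it sends the `k`-th power
of the augmentation ideal into multiples of `X^k`; a matrix divisible by all powers of `X` is zero.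
-/
theorem eq_one_of_forall_mem_augmentation_pow (g : FreeGroup (Fin 2))
    (hg : ∀ k : ℕ, MonoidAlgebra.of ℝ _ g - 1 ∈ augmentation (FreeGroup (Fin 2)) ^ (k + 1)) :
    g = 1 := by
  apply injective_lift_elementaryUnit_X
  let ρ : FreeGroup (Fin 2) →* Matrix (Fin 2) (Fin 2) (Polynomial ℝ) :=
    (Units.coeHom _).comp (FreeGroup.lift (elementaryUnit (Polynomial.X : Polynomial ℝ)))
  let σ := MonoidAlgebra.lift ℝ (Matrix (Fin 2) (Fin 2) (Polynomial ℝ)) (FreeGroup (Fin 2)) ρ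
  have hσ (g) : σ (MonoidAlgebra.of ℝ _ g) = ρ g := MonoidAlgebra.lift_of _ _
  have h1 : ∀ a ∈ augmentation (FreeGroup (Fin 2)),
      ∃ b, σ a = (Polynomial.X : Polynomial ℝ) • b := by
    intro a ha
    induction ha using Submodule.span_induction with
    | mem a ha =>
      obtain ⟨g, rfl⟩ := ha
      simp only [map_sub, hσ, map_one]
      induction g using FreeGroup.induction_on with
      | C1 => exact ⟨0, by simp⟩
      | of i =>
        fin_cases i
        · exact ⟨!![0, 1; 0, 0], by
            ext i j; fin_cases i <;> fin_cases j <;> simp [ρ, elementaryUnit]⟩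
        · exact ⟨!![0, 0; 1, 0], by
            ext i j; fin_cases i <;> fin_cases j <;> simp [ρ, elementaryUnit]⟩
      | inv_of i _ =>
        fin_cases i
        · exact ⟨!![0, -1; 0, 0], by
            ext i j; fin_cases i <;> fin_cases j <;> simp [ρ, elementaryUnit]⟩
        · exact ⟨!![0, 0; -1, 0], by
            ext i j; fin_cases i <;> fin_cases j <;> simp [ρ, elementaryUnit]⟩
      | mul g h hg hh =>
        obtain ⟨b, hb⟩ := hg
        obtain ⟨c, hc⟩ := hh
        -- From `ρ(gh) - 1 = (ρ(g) - 1) ρ(h) + (ρ(h) - 1)`.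
        refine ⟨b * ρ h + c, ?_⟩
        rw [smul_add, ← smul_mul_assoc, ← hb, ← hc, map_mul]
        noncomm_ring
    | zero => exact ⟨0, by simp⟩
    | add p q _ _ hp hq =>
      obtain ⟨b, hb⟩ := hp
      obtain ⟨c, hc⟩ := hq
      exact ⟨b + c, by rw [map_add, hb, hc, smul_add]⟩
    | smul r p _ hp =>
      obtain ⟨b, hb⟩ := hp
      exact ⟨r • b, by rw [map_smul, hb, smul_comm]⟩
  have h2 : ρ g - 1 = 0 := by
    ext i j n
    obtain ⟨b, hb⟩ := exists_smul_of_mem_augmentation_pow Polynomial.X σ h1 (n + 1) _ (hg n)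
    rw [map_sub, hσ, map_one] at hb
    rw [hb, Matrix.smul_apply, smul_eq_mul, Matrix.zero_apply, Polynomial.coeff_zero]
    exact Polynomial.X_pow_dvd_iff.mp (dvd_mul_right _ _) n n.lt_succ_self
  rw [map_one]
  exact Units.ext (sub_eq_zero.mp h2)

/-! ### Magnus expansion and the graded pieces of the augmentation filtration. -/

section Magnus

variable (a : Fin 2 → ℝ)

/-- Left multiplication by `1 + ∑ aᵢ ξᵢ` on noncommutative power series in `ξ₀`, `ξ₁`, which are
represented by their coefficient functions. -/
def magnusMul (f : List (Fin 2) → ℝ) : List (Fin 2) → ℝ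
  | [] => f []
  | i :: l => f (i :: l) + a i * f l

/-- Left multiplication by `(1 + ∑ aᵢ ξᵢ)⁻¹` on noncommutative power series. -/
def magnusDiv (f : List (Fin 2) → ℝ) : List (Fin 2) → ℝ
  | [] => f []
  | i :: l => f (i :: l) - a i * magnusDiv f l

/-- Multiplication by `1 + ∑ aᵢ ξᵢ` as a linear automorphism. -/
def magnusEquiv : (List (Fin 2) → ℝ) ≃ₗ[ℝ] (List (Fin 2) → ℝ) where
  toFun := magnusMul a
  invFun := magnusDiv a
  map_add' f g := by
    funext l; cases l
    · rfl
    · simp only [magnusMul, Pi.add_apply]; ring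
  map_smul' r f := by
    funext l; cases l
    · rfl
    · simp only [magnusMul, Pi.smul_apply, smul_eq_mul, RingHom.id_apply]; ring
  left_inv f := by
    funext l
    induction l with
    | nil => rfl
    | cons i l ih => simp only [magnusDiv, magnusMul, ih]; ring
  right_inv f := by
    funext l; cases l
    · rfl
    · simp only [magnusDiv, magnusMul]; ring

variable (ell : Fin 2 → Fin 2 → ℝ)

/-- The Magnus representation of `F₂` on power series, sending the `j`-th generator to
`1 + ∑ᵢ (ell i j) ξᵢ`. -/
def magnus : FreeGroup (Fin 2) →* ((List (Fin 2) → ℝ) ≃ₗ[ℝ] (List (Fin 2) → ℝ)) :=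
  FreeGroup.lift fun j => magnusEquiv fun i => ell i j

/-- The coefficient of `ξᵢ` in the Magnus expansion. -/
def linearCoeff (i : Fin 2) (g : FreeGroup (Fin 2)) : ℝ :=
  ell i 0 * expSum 0 g + ell i 1 * expSum 1 g

theorem linearCoeff_mul (i : Fin 2) (g h : FreeGroup (Fin 2)) :
    linearCoeff ell i (g * h) = linearCoeff ell i g + linearCoeff ell i h := by
  simp [linearCoeff]; ring

theorem linearCoeff_inv (i : Fin 2) (g : FreeGroup (Fin 2)) :
    linearCoeff ell i g⁻¹ = -linearCoeff ell i g := by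
  simp [linearCoeff]; ring

theorem linearCoeff_of (i j : Fin 2) : linearCoeff ell i (FreeGroup.of j) = ell i j := by
  fin_cases j <;> simp [linearCoeff]

theorem magnus_apply_of (j : Fin 2) (f : List (Fin 2) → ℝ) :
    magnus ell (FreeGroup.of j) f = magnusMul (fun i => ell i j) f := by
  simp [magnus, magnusEquiv]

theorem magnus_apply_inv_of (j : Fin 2) (f : List (Fin 2) → ℝ) :
    magnus ell (FreeGroup.of j)⁻¹ f = magnusDiv (fun i => ell i j) f := by
  simp only [magnus, map_inv, FreeGroup.lift_apply_of]
  rfl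

/-- The action of the Magnus representation on the lowest terms of a power series. -/
theorem magnus_lowest (g : FreeGroup (Fin 2)) : ∀ (k : ℕ) (f : List (Fin 2) → ℝ),
    (∀ l, l.length < k → f l = 0) →
    (∀ l, l.length ≤ k → magnus ell g f l = f l) ∧
      ∀ i l, l.length = k → magnus ell g f (i :: l) = f (i :: l) + linearCoeff ell i g * f l := by
  induction g using FreeGroup.induction_on with
  | C1 => intro k f _; simp [linearCoeff]
  | of j =>
    intro k f hf
    rw [magnus_apply_of]
    simp only [linearCoeff_of]
    refine ⟨?_, fun i l _ => rfl⟩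
    rintro (_ | ⟨i, l⟩) hl
    · rfl
    · rw [magnusMul, hf l hl, mul_zero, add_zero]
  | inv_of j _ =>
    intro k f hf
    rw [magnus_apply_inv_of]
    simp only [linearCoeff_inv, linearCoeff_of]
    have key : ∀ l, l.length ≤ k → magnusDiv (fun i => ell i j) f l = f l := by
      intro l
      induction l with
      | nil => intro _; rfl
      | cons i l ih =>
        intro hl
        rw [magnusDiv, ih (Nat.le_of_succ_le hl), hf l hl, mul_zero, sub_zero]
    refine ⟨key, fun i l hl => ?_⟩
    rw [magnusDiv, key l hl.le]
    ring
  | mul g h hg hh =>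
    intro k f hf
    have h1 := hh k f hf
    have h2 := hg k (magnus ell h f) fun l hl => by rw [h1.1 l hl.le, hf l hl]
    rw [map_mul, LinearEquiv.mul_apply]
    refine ⟨fun l hl => by rw [h2.1 l hl, h1.1 l hl], fun i l hl => ?_⟩
    rw [h2.2 i l hl, h1.2 i l hl, h1.1 l hl.le, linearCoeff_mul]
    ring

/-- The constant term is 1, so inverses introduce no denominators. -/
theorem magnus_mem_subring (R : Subring ℝ) (hR : ∀ i j, ell i j ∈ R) (g : FreeGroup (Fin 2)) :
    ∀ f : List (Fin 2) → ℝ, (∀ l, f l ∈ R) → ∀ l, magnus ell g f l ∈ R := by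
  induction g using FreeGroup.induction_on with
  | C1 => intro f hf; simpa using hf
  | of j =>
    intro f hf l
    rw [magnus_apply_of]
    cases l with
    | nil => exact hf _
    | cons i l => exact add_mem (hf _) (mul_mem (hR _ _) (hf _))
  | inv_of j _ =>
    intro f hf l
    rw [magnus_apply_inv_of]
    induction l with
    | nil => exact hf _
    | cons i l ih => exact sub_mem (hf _) (mul_mem (hR _ _) ih)
  | mul g h hg hh =>
    intro f hf
    rw [map_mul, LinearEquiv.mul_apply]
    exact hg _ (hh _ hf)

/-- The extension of the Magnus representation to the group algebra. -/
noncomputable def magnusAlg :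
    MonoidAlgebra ℝ (FreeGroup (Fin 2)) →ₐ[ℝ] Module.End ℝ (List (Fin 2) → ℝ) :=
  MonoidAlgebra.lift ℝ _ (FreeGroup (Fin 2))
    (LinearEquiv.automorphismGroup.toLinearMapMonoidHom.comp (magnus ell))

theorem magnusAlg_of (g : FreeGroup (Fin 2)) (f : List (Fin 2) → ℝ) :
    magnusAlg ell (MonoidAlgebra.of ℝ _ g) f = magnus ell g f := by
  rw [magnusAlg, MonoidAlgebra.lift_of]
  rfl

/-- The coefficient of the word `l` in the Magnus expansion of an element of the group algebra. -/
noncomputable def magnusCoeff (l : List (Fin 2)) : MonoidAlgebra ℝ (FreeGroup (Fin 2)) →ₗ[ℝ] ℝ where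
  toFun x := magnusAlg ell x (Pi.single [] 1) l
  map_add' x y := by simp
  map_smul' r x := by simp

theorem magnusCoeff_singleton_of_sub_one (i : Fin 2) (g : FreeGroup (Fin 2)) :
    magnusCoeff ell [i] (MonoidAlgebra.of ℝ _ g - 1) = linearCoeff ell i g := by
  have := (magnus_lowest ell g 0 (Pi.single [] 1) (by simp)).2 i [] rfl
  rw [map_sub]
  simp only [magnusCoeff, LinearMap.coe_mk, AddHom.coe_mk, magnusAlg_of, this]
  simp

/-- An augmentation element raises the order of a series by one and multiplies the lowest terms by
its own linear part; this makes leading coefficients multiplicative. -/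
theorem magnusAlg_augmentation {b : MonoidAlgebra ℝ (FreeGroup (Fin 2))}
    (hb : b ∈ augmentation (FreeGroup (Fin 2))) {k : ℕ} {f : List (Fin 2) → ℝ}
    (hf : ∀ l, l.length < k → f l = 0) :
    (∀ l, l.length < k + 1 → magnusAlg ell b f l = 0) ∧
      ∀ i l, l.length = k → magnusAlg ell b f (i :: l) = magnusCoeff ell [i] b * f l := by
  induction hb using Submodule.span_induction with
  | mem b hb =>
    obtain ⟨g, rfl⟩ := hb
    have h := magnus_lowest ell g k f hf
    refine ⟨fun l hl => ?_, fun i l hl => ?_⟩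
    · simp [-MonoidAlgebra.of_apply, magnusAlg_of, h.1 l (Nat.le_of_lt_succ hl)]
    · rw [magnusCoeff_singleton_of_sub_one]
      simp [-MonoidAlgebra.of_apply, magnusAlg_of, h.2 i l hl]
  | zero => simp
  | add x y _ _ hx hy =>
    refine ⟨fun l hl => ?_, fun i l hl => ?_⟩
    · simp [hx.1 l hl, hy.1 l hl]
    · simp [hx.2 i l hl, hy.2 i l hl, add_mul]
  | smul r x _ hx =>
    refine ⟨fun l hl => ?_, fun i l hl => ?_⟩
    · simp [hx.1 l hl]
    · simp [hx.2 i l hl, mul_assoc]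

theorem magnusCoeff_eq_zero {k : ℕ} {x : MonoidAlgebra ℝ (FreeGroup (Fin 2))}
    (hx : x ∈ augmentation (FreeGroup (Fin 2)) ^ k) :
    ∀ l, l.length < k → magnusCoeff ell l x = 0 := by
  induction k generalizing x with
  | zero => simp
  | succ k ih =>
    rw [pow_succ'] at hx
    induction hx using Submodule.mul_induction_on' with
    | mem_mul_mem b hb y hy =>
      intro l hl
      simpa [magnusCoeff] using (magnusAlg_augmentation ell hb (ih hy)).1 l hl
    | add x _ y _ hx hy => intro l hl; rw [map_add, hx l hl, hy l hl, add_zero]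

theorem magnusCoeff_cons_mul {k : ℕ} {b x : MonoidAlgebra ℝ (FreeGroup (Fin 2))}
    (hb : b ∈ augmentation (FreeGroup (Fin 2))) (hx : x ∈ augmentation (FreeGroup (Fin 2)) ^ k)
    (i : Fin 2) {l : List (Fin 2)} (hl : l.length = k) :
    magnusCoeff ell (i :: l) (b * x) = magnusCoeff ell [i] b * magnusCoeff ell l x := by
  have := (magnusAlg_augmentation ell hb (magnusCoeff_eq_zero ell hx)).2 i l hl
  simpa [magnusCoeff] using this

/-- An endomorphism of `F₂` for which the linear coefficients are eigenvectors acts diagonally on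
the leading Magnus coefficients. -/
theorem magnusCoeff_map (α : FreeGroup (Fin 2) →* FreeGroup (Fin 2)) (ev : Fin 2 → ℝ)
    (hα : ∀ i g, linearCoeff ell i (α g) = ev i * linearCoeff ell i g) {k : ℕ}
    {x : MonoidAlgebra ℝ (FreeGroup (Fin 2))} (hx : x ∈ augmentation (FreeGroup (Fin 2)) ^ k) :
    MonoidAlgebra.mapDomainAlgHom ℝ ℝ α x ∈ augmentation (FreeGroup (Fin 2)) ^ k ∧
      ∀ l, l.length = k → magnusCoeff ell l (MonoidAlgebra.mapDomainAlgHom ℝ ℝ α x) =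
        (l.map ev).prod * magnusCoeff ell l x := by
  -- Degree one is settled first; the general degree follows since leading coefficients of products
  -- multiply along the word.
  have h1 {b} (hb : b ∈ augmentation (FreeGroup (Fin 2))) :
      MonoidAlgebra.mapDomainAlgHom ℝ ℝ α b ∈ augmentation (FreeGroup (Fin 2)) ∧
      ∀ i, magnusCoeff ell [i] (MonoidAlgebra.mapDomainAlgHom ℝ ℝ α b) =
        ev i * magnusCoeff ell [i] b := by
    induction hb using Submodule.span_induction with
    | mem b hb =>
      obtain ⟨g, rfl⟩ := hb
      have hg : MonoidAlgebra.mapDomainAlgHom ℝ ℝ α (MonoidAlgebra.of ℝ _ g - 1) =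
          MonoidAlgebra.of ℝ _ (α g) - 1 := by
        rw [map_sub, map_one]; simp
      rw [hg]
      refine ⟨of_sub_one_mem_augmentation _, fun i => ?_⟩
      rw [magnusCoeff_singleton_of_sub_one, magnusCoeff_singleton_of_sub_one, hα]
    | zero => simp
    | add x y _ _ hx hy =>
      refine ⟨by rw [map_add]; exact add_mem hx.1 hy.1, fun i => ?_⟩
      rw [map_add, map_add, map_add, hx.2, hy.2, mul_add]
    | smul r x _ hx =>
      refine ⟨by rw [map_smul]; exact Submodule.smul_mem _ _ hx.1, fun i => ?_⟩
      rw [map_smul, map_smul, map_smul, hx.2, smul_eq_mul, smul_eq_mul, mul_left_comm]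
  induction k generalizing x with
  | zero =>
    rw [pow_zero, Submodule.mem_one] at hx ⊢
    obtain ⟨r, rfl⟩ := hx
    refine ⟨⟨r, by rw [AlgHom.commutes]⟩, fun l hl => ?_⟩
    rw [List.length_eq_zero_iff.mp hl, AlgHom.commutes]
    simp
  | succ k ih =>
    rw [pow_succ'] at hx ⊢
    induction hx using Submodule.mul_induction_on' with
    | mem_mul_mem b hb y hy =>
      obtain ⟨hb1, hb2⟩ := h1 hb
      obtain ⟨hy1, hy2⟩ := ih hy
      rw [map_mul]
      refine ⟨Submodule.mul_mem_mul hb1 hy1, ?_⟩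
      rintro (_ | ⟨i, l⟩) hl
      · simp at hl
      · have hl : l.length = k := by simpa using hl
        rw [magnusCoeff_cons_mul ell hb1 hy1 i hl, magnusCoeff_cons_mul ell hb hy i hl, hb2,
          hy2 l hl, List.map_cons, List.prod_cons]
        ring
    | add x _ y _ hx hy =>
      refine ⟨by rw [map_add]; exact add_mem hx.1 hy.1, fun l hl => ?_⟩
      rw [map_add, map_add, map_add, hx.2 l hl, hy.2 l hl, mul_add]

/-- Modulo the square of the augmentation ideal, `g ↦ g - 1` is additive, because `gh - 1 = (g - 1)
+ (h - 1) + (g - 1)(h - 1)`. -/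
theorem of_sub_one_sub_linear_mem (g : FreeGroup (Fin 2)) :
    MonoidAlgebra.of ℝ _ g - 1 - ∑ j, (expSum j g : ℝ) • (MonoidAlgebra.of ℝ _ (FreeGroup.of j) - 1)
      ∈ augmentation (FreeGroup (Fin 2)) ^ 2 := by
  have hmem (g h : FreeGroup (Fin 2)) : (MonoidAlgebra.of ℝ _ g - 1) * (MonoidAlgebra.of ℝ _ h - 1)
      ∈ augmentation (FreeGroup (Fin 2)) ^ 2 := by
    rw [sq]
    exact Submodule.mul_mem_mul (of_sub_one_mem_augmentation _) (of_sub_one_mem_augmentation _)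
  induction g using FreeGroup.induction_on with
  | C1 => simp [-MonoidAlgebra.of_apply]
  | of i => fin_cases i <;> simp [-MonoidAlgebra.of_apply]
  | inv_of i h =>
    convert sub_mem (neg_mem h) (hmem (FreeGroup.of i) (FreeGroup.of i)⁻¹) using 1
    have : (MonoidAlgebra.of ℝ _ (FreeGroup.of i)) * (MonoidAlgebra.of ℝ _ (FreeGroup.of i)⁻¹) =
      1 := by rw [← map_mul, mul_inv_cancel, map_one]
    simp only [expSum_inv, Int.cast_neg, neg_smul, Finset.sum_neg_distrib, sub_mul, mul_sub, this]
    noncomm_ring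
  | mul g h hg hh =>
    convert add_mem (add_mem hg hh) (hmem g h) using 1
    simp only [expSum_mul, Int.cast_add, add_smul, Finset.sum_add_distrib, map_mul]
    noncomm_ring

variable (kap : Fin 2 → Fin 2 → ℝ)

/-- The element of the group algebra with Magnus expansion `ξᵢ + ⋯`, where `kap` is inverse to
`ell`. -/
noncomputable def dualVariable (i : Fin 2) : MonoidAlgebra ℝ (FreeGroup (Fin 2)) :=
  ∑ j, kap i j • (MonoidAlgebra.of ℝ _ (FreeGroup.of j) - 1)

theorem dualVariable_mem (i : Fin 2) :
    dualVariable kap i ∈ augmentation (FreeGroup (Fin 2)) :=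
  Submodule.sum_mem _ fun _ _ => Submodule.smul_mem _ _ (of_sub_one_mem_augmentation _)

/-- The homogeneous polynomial of degree `k` with given coefficients in the dual variables. -/
noncomputable def dualPolynomial :
    ℕ → (List (Fin 2) → ℝ) →ₗ[ℝ] MonoidAlgebra ℝ (FreeGroup (Fin 2))
  | 0 => (LinearMap.proj []).smulRight 1
  | k + 1 => ∑ i, LinearMap.mulLeft ℝ (dualVariable kap i) ∘ₗ dualPolynomial k ∘ₗ
      LinearMap.funLeft ℝ ℝ (List.cons i)

theorem dualPolynomial_succ (k : ℕ) (c : List (Fin 2) → ℝ) :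
    dualPolynomial kap (k + 1) c =
      ∑ i, dualVariable kap i * dualPolynomial kap k fun l => c (i :: l) := by
  rw [dualPolynomial, LinearMap.sum_apply]
  rfl

theorem dualPolynomial_congr {k : ℕ} {c d : List (Fin 2) → ℝ}
    (h : ∀ l, l.length = k → c l = d l) : dualPolynomial kap k c = dualPolynomial kap k d := by
  induction k generalizing c d with
  | zero => simp [dualPolynomial, h [] rfl]
  | succ k ih =>
    rw [dualPolynomial_succ, dualPolynomial_succ]
    refine Finset.sum_congr rfl fun i _ => ?_
    rw [ih fun l hl => h (i :: l) (by simp [hl])]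

variable {ell kap}

theorem sub_linear_mem (hk : ∀ m j, ∑ i, ell i m * kap i j = if m = j then 1 else 0)
    {b : MonoidAlgebra ℝ (FreeGroup (Fin 2))} (hb : b ∈ augmentation (FreeGroup (Fin 2))) :
    b - ∑ i, magnusCoeff ell [i] b • dualVariable kap i ∈
      augmentation (FreeGroup (Fin 2)) ^ 2 := by
  induction hb using Submodule.span_induction with
  | mem b hb =>
    obtain ⟨g, rfl⟩ := hb
    convert of_sub_one_sub_linear_mem g using 2
    simp only [magnusCoeff_singleton_of_sub_one, dualVariable, Finset.smul_sum, smul_smul]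
    rw [Finset.sum_comm]
    refine Finset.sum_congr rfl fun j _ => ?_
    rw [← Finset.sum_smul]
    congr 1
    have h0 := hk 0 j
    have h1 := hk 1 j
    rw [Fin.sum_univ_two] at h0 h1 ⊢
    simp only [linearCoeff]
    have : (expSum j g : ℝ) = expSum 0 g * (if (0 : Fin 2) = j then 1 else 0) +
        expSum 1 g * (if (1 : Fin 2) = j then 1 else 0) := by
      fin_cases j <;> simp
    rw [this, ← h0, ← h1]
    ring
  | zero => simp
  | add x y _ _ hx hy =>
    convert add_mem hx hy using 1
    simp only [map_add, add_smul, Finset.sum_add_distrib]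
    abel
  | smul r x _ hx =>
    convert Submodule.smul_mem _ r hx using 1
    simp only [map_smul, smul_sub, Finset.smul_sum, smul_smul, smul_eq_mul]

/-- Leading coefficients determine an element modulo the next power of the ideal. This gives the
converse of `magnusCoeff_eq_zero` needed in `mem_augmentation_pow_succ`. -/
theorem sub_dualPolynomial_mem (hk : ∀ m j, ∑ i, ell i m * kap i j = if m = j then 1 else 0)
    {k : ℕ} {x : MonoidAlgebra ℝ (FreeGroup (Fin 2))}
    (hx : x ∈ augmentation (FreeGroup (Fin 2)) ^ k) :
    x - dualPolynomial kap k (fun l => magnusCoeff ell l x) ∈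
      augmentation (FreeGroup (Fin 2)) ^ (k + 1) := by
  induction k generalizing x with
  | zero =>
    rw [pow_zero, Submodule.mem_one] at hx
    obtain ⟨r, rfl⟩ := hx
    convert Submodule.zero_mem _ using 1
    rw [sub_eq_zero]
    simp only [dualPolynomial, magnusCoeff, LinearMap.coe_mk, AddHom.coe_mk, AlgHom.commutes]
    simp [Algebra.algebraMap_eq_smul_one]
  | succ k ih =>
    rw [pow_succ'] at hx
    induction hx using Submodule.mul_induction_on' with
    | mem_mul_mem b hb y hy =>
      have h1 : dualPolynomial kap (k + 1) (fun l => magnusCoeff ell l (b * y)) =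
          ∑ i, (magnusCoeff ell [i] b • dualVariable kap i) *
            dualPolynomial kap k (fun l => magnusCoeff ell l y) := by
        rw [dualPolynomial_succ]
        refine Finset.sum_congr rfl fun i _ => ?_
        rw [dualPolynomial_congr kap (d := magnusCoeff ell [i] b • fun l => magnusCoeff ell l y),
          map_smul, mul_smul_comm, smul_mul_assoc]
        intro l hl
        exact magnusCoeff_cons_mul ell hb hy i hl
      rw [h1, ← Finset.sum_mul]
      -- With `L` the linear part of `b` and `P` the leading polynomial of `y`: `b y - L P = (b - L)
      -- y + L (y - P)`.
      have h2 := Submodule.mul_mem_mul (sub_linear_mem hk hb) hy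
      have h3 := Submodule.mul_mem_mul (Submodule.sum_mem _ fun i (_ : i ∈ Finset.univ) =>
        Submodule.smul_mem _ (magnusCoeff ell [i] b) (dualVariable_mem kap i)) (ih hy)
      rw [← pow_add, add_comm 2 k] at h2
      rw [← pow_succ'] at h3
      convert add_mem h2 h3 using 1
      noncomm_ring
    | add x _ y _ hx hy =>
      convert add_mem hx hy using 1
      have : (fun l => magnusCoeff ell l (x + y)) =
          (fun l => magnusCoeff ell l x) + fun l => magnusCoeff ell l y := by
        funext l; simp
      rw [this, map_add]
      abel

theorem mem_augmentation_pow_succ (hk : ∀ m j, ∑ i, ell i m * kap i j = if m = j then 1 else 0)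
    {k : ℕ} {x : MonoidAlgebra ℝ (FreeGroup (Fin 2))}
    (hx : x ∈ augmentation (FreeGroup (Fin 2)) ^ k)
    (h : ∀ l, l.length = k → magnusCoeff ell l x = 0) :
    x ∈ augmentation (FreeGroup (Fin 2)) ^ (k + 1) := by
  have h1 := sub_dualPolynomial_mem hk hx
  rwa [dualPolynomial_congr kap (d := 0) h, map_zero, sub_zero] at h1

theorem magnusCoeff_of_sub_one_mem (R : Subring ℝ) (hR : ∀ i j, ell i j ∈ R)
    (g : FreeGroup (Fin 2)) (l : List (Fin 2)) :
    magnusCoeff ell l (MonoidAlgebra.of ℝ _ g - 1) ∈ R := by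
  have hδ : ∀ l, (Pi.single [] 1 : List (Fin 2) → ℝ) l ∈ R := by
    intro l
    rw [Pi.single_apply]
    split_ifs
    · exact one_mem R
    · exact zero_mem R
  have h1 := magnus_mem_subring ell R hR g _ hδ l
  rw [← map_one (MonoidAlgebra.of ℝ (FreeGroup (Fin 2))), map_sub]
  refine sub_mem ?_ ?_
  · simpa only [magnusCoeff, LinearMap.coe_mk, AddHom.coe_mk, magnusAlg_of] using h1
  · simpa only [magnusCoeff, LinearMap.coe_mk, AddHom.coe_mk, magnusAlg_of] using
      magnus_mem_subring ell R hR 1 _ hδ l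

end Magnus

/-! ### Divisibility of leading coefficients along the lower central series. -/

section Filtration

variable (ell : Fin 2 → Fin 2 → ℝ) (ev : Fin 2 → ℝ) (R : Subring ℝ)

theorem of_mul_sub_one {F : Type*} [Group F] (g h : F) :
    MonoidAlgebra.of ℝ F (g * h) - 1 = (MonoidAlgebra.of ℝ F g - 1) + (MonoidAlgebra.of ℝ F h - 1) +
      (MonoidAlgebra.of ℝ F g - 1) * (MonoidAlgebra.of ℝ F h - 1) := by
  rw [map_mul]; noncomm_ring

theorem of_inv_sub_one {F : Type*} [Group F] (g : F) :
    MonoidAlgebra.of ℝ F g⁻¹ - 1 = -(MonoidAlgebra.of ℝ F g - 1) -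
      (MonoidAlgebra.of ℝ F g - 1) * (MonoidAlgebra.of ℝ F g⁻¹ - 1) := by
  have : MonoidAlgebra.of ℝ F g * MonoidAlgebra.of ℝ F g⁻¹ = 1 := by
    rw [← map_mul, mul_inv_cancel, map_one]
  rw [sub_mul, mul_sub, this]
  noncomm_ring

/-- Every correction term contains `g - 1` and one more augmentation factor, so conjugation is
invisible in the leading degree. -/
theorem of_conj_sub_one {F : Type*} [Group F] (f g : F) :
    MonoidAlgebra.of ℝ F (f * g * f⁻¹) - 1 = (MonoidAlgebra.of ℝ F g - 1) +
      ((MonoidAlgebra.of ℝ F f - 1) * (MonoidAlgebra.of ℝ F g - 1) +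
        ((MonoidAlgebra.of ℝ F g - 1) + (MonoidAlgebra.of ℝ F f - 1) *
          (MonoidAlgebra.of ℝ F g - 1)) * (MonoidAlgebra.of ℝ F f⁻¹ - 1)) := by
  have : MonoidAlgebra.of ℝ F f * MonoidAlgebra.of ℝ F f⁻¹ = 1 := by
    rw [← map_mul, mul_inv_cancel, map_one]
  rw [map_mul, map_mul]
  generalize MonoidAlgebra.of ℝ F f = x at *
  generalize MonoidAlgebra.of ℝ F f⁻¹ = y at *
  generalize MonoidAlgebra.of ℝ F g = z at *
  have h : x * z * y - 1 = x * z * y - x * y := by rw [this]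
  rw [h]
  noncomm_ring

section Coeff

variable {ell} {k : ℕ} {g h : FreeGroup (Fin 2)}

theorem mul_mem_and_magnusCoeff (hk : 1 ≤ k)
    (hg : MonoidAlgebra.of ℝ _ g - 1 ∈ augmentation (FreeGroup (Fin 2)) ^ k)
    (hh : MonoidAlgebra.of ℝ _ h - 1 ∈ augmentation (FreeGroup (Fin 2)) ^ k) :
    MonoidAlgebra.of ℝ _ (g * h) - 1 ∈ augmentation (FreeGroup (Fin 2)) ^ k ∧
    ∀ l, l.length = k → magnusCoeff ell l (MonoidAlgebra.of ℝ _ (g * h) - 1) =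
      magnusCoeff ell l (MonoidAlgebra.of ℝ _ g - 1) +
        magnusCoeff ell l (MonoidAlgebra.of ℝ _ h - 1) := by
  have h1 : (MonoidAlgebra.of ℝ _ g - 1) * (MonoidAlgebra.of ℝ _ h - 1) ∈
      augmentation (FreeGroup (Fin 2)) ^ (k + 1) := by
    rw [pow_succ]; exact Submodule.mul_mem_mul hg (of_sub_one_mem_augmentation h)
  rw [of_mul_sub_one]
  refine ⟨add_mem (add_mem hg hh) (augmentation_pow_antitone hk k.le_succ h1), fun l hl => ?_⟩
  rw [map_add, map_add, magnusCoeff_eq_zero ell h1 l (by omega), add_zero]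

theorem inv_mem_and_magnusCoeff (hk : 1 ≤ k)
    (hg : MonoidAlgebra.of ℝ _ g - 1 ∈ augmentation (FreeGroup (Fin 2)) ^ k) :
    MonoidAlgebra.of ℝ _ g⁻¹ - 1 ∈ augmentation (FreeGroup (Fin 2)) ^ k ∧
    ∀ l, l.length = k → magnusCoeff ell l (MonoidAlgebra.of ℝ _ g⁻¹ - 1) =
      -magnusCoeff ell l (MonoidAlgebra.of ℝ _ g - 1) := by
  have h1 : (MonoidAlgebra.of ℝ _ g - 1) * (MonoidAlgebra.of ℝ _ g⁻¹ - 1) ∈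
      augmentation (FreeGroup (Fin 2)) ^ (k + 1) := by
    rw [pow_succ]; exact Submodule.mul_mem_mul hg (of_sub_one_mem_augmentation g⁻¹)
  rw [of_inv_sub_one]
  refine ⟨sub_mem (neg_mem hg) (augmentation_pow_antitone hk k.le_succ h1), fun l hl => ?_⟩
  rw [map_sub, map_neg, magnusCoeff_eq_zero ell h1 l (by omega), sub_zero]

theorem conj_mem_and_magnusCoeff (hk : 1 ≤ k) (f : FreeGroup (Fin 2))
    (hg : MonoidAlgebra.of ℝ _ g - 1 ∈ augmentation (FreeGroup (Fin 2)) ^ k) :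
    MonoidAlgebra.of ℝ _ (f * g * f⁻¹) - 1 ∈ augmentation (FreeGroup (Fin 2)) ^ k ∧
    ∀ l, l.length = k → magnusCoeff ell l (MonoidAlgebra.of ℝ _ (f * g * f⁻¹) - 1) =
      magnusCoeff ell l (MonoidAlgebra.of ℝ _ g - 1) := by
  have h0 : (MonoidAlgebra.of ℝ _ f - 1) * (MonoidAlgebra.of ℝ _ g - 1) ∈
      augmentation (FreeGroup (Fin 2)) ^ (k + 1) := by
    rw [pow_succ']; exact Submodule.mul_mem_mul (of_sub_one_mem_augmentation f) hg
  have h1 : ((MonoidAlgebra.of ℝ _ g - 1) + (MonoidAlgebra.of ℝ _ f - 1) *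
      (MonoidAlgebra.of ℝ _ g - 1)) * (MonoidAlgebra.of ℝ _ f⁻¹ - 1) ∈
      augmentation (FreeGroup (Fin 2)) ^ (k + 1) := by
    rw [pow_succ]
    exact Submodule.mul_mem_mul (add_mem hg (augmentation_pow_antitone hk k.le_succ h0))
      (of_sub_one_mem_augmentation f⁻¹)
  rw [of_conj_sub_one]
  refine ⟨add_mem hg (augmentation_pow_antitone hk k.le_succ (add_mem h0 h1)), fun l hl => ?_⟩
  rw [map_add, magnusCoeff_eq_zero ell (add_mem h0 h1) l (by omega), add_zero]

end Coeff

/-- The elements `g` of the `k`-th dimension subgroup whose leading Magnus coefficients are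
divisible in `R` by the `n`-th powers of `χ - 1`, with `χ` the corresponding eigenvalues. -/
noncomputable def eigenFiltration (k : ℕ) (hk : 1 ≤ k) (n : ℕ) : Subgroup (FreeGroup (Fin 2)) where
  carrier := {g | MonoidAlgebra.of ℝ _ g - 1 ∈ augmentation (FreeGroup (Fin 2)) ^ k ∧
    ∀ l, l.length = k → ∃ r ∈ R, magnusCoeff ell l (MonoidAlgebra.of ℝ _ g - 1) =
      ((l.map ev).prod - 1) ^ n * r}
  one_mem' := by
    refine ⟨by rw [map_one, sub_self]; exact zero_mem _, fun l _ => ⟨0, zero_mem R, ?_⟩⟩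
    rw [map_one, sub_self, map_zero, mul_zero]
  mul_mem' := by
    rintro g h ⟨hg, hg'⟩ ⟨hh, hh'⟩
    have key := mul_mem_and_magnusCoeff (ell := ell) hk hg hh
    refine ⟨key.1, fun l hl => ?_⟩
    obtain ⟨r, hr, h1⟩ := hg' l hl
    obtain ⟨r', hr', h2⟩ := hh' l hl
    exact ⟨r + r', add_mem hr hr', by rw [key.2 l hl, h1, h2, mul_add]⟩
  inv_mem' := by
    rintro g ⟨hg, hg'⟩
    have key := inv_mem_and_magnusCoeff (ell := ell) hk hg
    refine ⟨key.1, fun l hl => ?_⟩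
    obtain ⟨r, hr, h1⟩ := hg' l hl
    exact ⟨-r, neg_mem hr, by rw [key.2 l hl, h1, mul_neg]⟩

theorem exists_zpow_sub_one_eq {R : Subring ℝ} {x : ℝ} (hx : x ∈ R) (hx' : x⁻¹ ∈ R) (n : ℤ) :
    ∃ r ∈ R, x ^ n - 1 = (x - 1) * r := by
  have hnat (n : ℕ) : ∃ r ∈ R, x ^ n - 1 = (x - 1) * r :=
    ⟨∑ i ∈ Finset.range n, x ^ i, sum_mem fun i _ => pow_mem hx i,
      by rw [mul_comm, geom_sum_mul]⟩
  rcases n with n | n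
  · simpa using hnat n
  -- The hypotheses allow `x = 0`, since `0⁻¹ = 0`; the left side is then `-1`.
  · rcases eq_or_ne x 0 with rfl | h0
    · exact ⟨1, one_mem R, by simp⟩
    · obtain ⟨r, hr, h⟩ := hnat (n + 1)
      refine ⟨-(x⁻¹ ^ (n + 1)) * r, mul_mem (neg_mem (pow_mem hx' _)) hr, ?_⟩
      rw [zpow_negSucc, ← mul_assoc, mul_comm (x - 1), mul_assoc, ← h, mul_sub, neg_mul, ← mul_pow,
        inv_mul_cancel₀ h0, one_pow, mul_one, inv_pow, sub_neg_eq_add, neg_add_eq_sub]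

theorem prod_map_zpow (l : List (Fin 2)) (n : ℤ) :
    (l.map fun i => ev i ^ n).prod = (l.map ev).prod ^ n := by
  induction l with
  | nil => simp
  | cons i l ih => rw [List.map_cons, List.prod_cons, ih, List.map_cons, List.prod_cons, mul_zpow]

variable {ell ev R} {φ : MulAut (FreeGroup (Fin 2))}

theorem linearCoeff_zpow (hev : ∀ i, ev i ≠ 0)
    (hφ : ∀ i g, linearCoeff ell i (φ g) = ev i * linearCoeff ell i g) (n : ℤ) (i : Fin 2)
    (g : FreeGroup (Fin 2)) :
    linearCoeff ell i ((φ ^ n) g) = ev i ^ n * linearCoeff ell i g := by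
  induction n generalizing g with
  | zero => simp
  | succ n ih => rw [zpow_add_one, MulAut.mul_apply, ih, hφ, zpow_add_one₀ (hev i), mul_assoc]
  | pred n ih =>
    rw [zpow_sub_one, MulAut.mul_apply, ih, zpow_sub_one₀ (hev i), mul_assoc]
    congr 1
    have h := hφ i (φ⁻¹ g)
    rw [MulAut.apply_inv_self] at h
    rw [h, inv_mul_cancel_left₀ (hev i)]

/-- The commutator of `m` with `u` is `m` times an `F₂`-conjugate of `(φ^j m)⁻¹`, so each leading
coefficient is multiplied by `1 - χ^j`. As `χ` is a unit of `R`, this is a multiple of `χ - 1` for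
every integer `j`. -/
theorem commutator_map_eigenFiltration_le (hev : ∀ i, ev i ≠ 0) (hevR : ∀ i, ev i ∈ R)
    (hevR' : ∀ i, (ev i)⁻¹ ∈ R)
    (hφ : ∀ i g, linearCoeff ell i (φ g) = ev i * linearCoeff ell i g) (k : ℕ) (hk : 1 ≤ k)
    (n : ℕ) :
    ⁅(eigenFiltration ell ev R k hk n).map
        (SemidirectProduct.inl : FreeGroup (Fin 2) →* FreeByZ φ), ⊤⁆ ≤
      (eigenFiltration ell ev R k hk (n + 1)).map
        (SemidirectProduct.inl : FreeGroup (Fin 2) →* FreeByZ φ) := by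
  rw [Subgroup.commutator_le]
  rintro _ ⟨m, ⟨hm, hm'⟩, rfl⟩ u _
  obtain ⟨j, hj⟩ : ∃ j : ℤ, zpowersHom (MulAut (FreeGroup (Fin 2))) φ⁻¹ u.right = φ ^ j :=
    ⟨-u.right.toAdd, by simp [zpowersHom_apply]⟩
  have h1 := magnusCoeff_map ell (φ ^ j).toMonoidHom (fun i => ev i ^ j)
    (linearCoeff_zpow hev hφ j) hm
  have h2 : MonoidAlgebra.mapDomainAlgHom ℝ ℝ (φ ^ j).toMonoidHom
      (MonoidAlgebra.of ℝ _ m - 1) = MonoidAlgebra.of ℝ _ ((φ ^ j) m) - 1 := by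
    rw [map_sub, map_one]; simp
  rw [h2] at h1
  have h3 := inv_mem_and_magnusCoeff (ell := ell) hk h1.1
  have h4 := conj_mem_and_magnusCoeff (ell := ell) hk u.left h3.1
  have h5 := mul_mem_and_magnusCoeff (ell := ell) hk hm h4.1
  refine ⟨m * (u.left * ((φ ^ j) m)⁻¹ * u.left⁻¹), ⟨h5.1, fun l hl => ?_⟩, ?_⟩
  · obtain ⟨r, hr, hr'⟩ := hm' l hl
    have hmem : (l.map ev).prod ∈ R := list_prod_mem fun x hx => by
      obtain ⟨i, -, rfl⟩ := List.mem_map.mp hx; exact hevR i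
    have hmem' : ((l.map ev).prod)⁻¹ ∈ R := by
      rw [← zpow_neg_one, ← prod_map_zpow]
      exact list_prod_mem fun x hx => by
        obtain ⟨i, -, rfl⟩ := List.mem_map.mp hx
        rw [zpow_neg_one]; exact hevR' i
    obtain ⟨q, hq, hq'⟩ := exists_zpow_sub_one_eq hmem hmem' j
    refine ⟨-(q * r), neg_mem (mul_mem hq hr), ?_⟩
    rw [h5.2 l hl, h4.2 l hl, h3.2 l hl, h1.2 l hl, prod_map_zpow, hr']
    linear_combination (-((l.map ev).prod - 1) ^ n * r) * hq'
  · ext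
    · simp [commutatorElement_def, ← hj, mul_assoc]
    · simp [commutatorElement_def]

/-- After `n` steps the degree `k` coefficients are divisible by `(χ - 1)^n`; by `hR` they vanish at
the limit, which leaves the next power of the augmentation ideal. -/
theorem transLowerCentral_add_omega0_le (kap : Fin 2 → Fin 2 → ℝ)
    (hkap : ∀ m j, ∑ i, ell i m * kap i j = if m = j then 1 else 0)
    (hellR : ∀ i j, ell i j ∈ R)
    (hev : ∀ i, ev i ≠ 0) (hevR : ∀ i, ev i ∈ R) (hevR' : ∀ i, (ev i)⁻¹ ∈ R)
    (hφ : ∀ i g, linearCoeff ell i (φ g) = ev i * linearCoeff ell i g)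
    (hR : ∀ l : List (Fin 2), ∀ x,
      (∀ n : ℕ, ∃ r ∈ R, x = ((l.map ev).prod - 1) ^ n * r) → x = 0)
    (k : ℕ) (hk : 1 ≤ k) (α : Ordinal) (hα : 1 ≤ α)
    (h : ∀ u ∈ transLowerCentral (FreeByZ φ) α, ∃ g, SemidirectProduct.inl g = u ∧
      MonoidAlgebra.of ℝ _ g - 1 ∈ augmentation (FreeGroup (Fin 2)) ^ k) :
    ∀ u ∈ transLowerCentral (FreeByZ φ) (α + Ordinal.omega0), ∃ g, SemidirectProduct.inl g = u ∧
      MonoidAlgebra.of ℝ _ g - 1 ∈ augmentation (FreeGroup (Fin 2)) ^ (k + 1) := by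
  have key (n : ℕ) : transLowerCentral (FreeByZ φ) (α + n) ≤
      (eigenFiltration ell ev R k hk n).map SemidirectProduct.inl := by
    induction n with
    | zero =>
      intro u hu
      rw [Nat.cast_zero, add_zero] at hu
      obtain ⟨g, rfl, hg⟩ := h u hu
      exact ⟨g, ⟨hg, fun l _ => ⟨_, magnusCoeff_of_sub_one_mem R hellR g l, by simp⟩⟩, rfl⟩
    | succ n ih =>
      rw [Nat.cast_succ, ← add_assoc, transLowerCentral_add_one _ _ (hα.trans le_self_add)]
      exact (Subgroup.commutator_mono ih le_rfl).trans
        (commutator_map_eigenFiltration_le hev hevR hevR' hφ k hk n)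
  intro u hu
  have hu' (n : ℕ) := key n (transLowerCentral_antitone _
    (by gcongr; exact (Ordinal.natCast_lt_omega0 n).le) hu)
  obtain ⟨g, hg, rfl⟩ := hu' 0
  refine ⟨g, rfl, mem_augmentation_pow_succ hkap hg.1 fun l hl => hR l _ fun n => ?_⟩
  obtain ⟨g', hg', hgg'⟩ := hu' n
  rw [SemidirectProduct.inl_injective hgg'] at hg'
  exact hg'.2 l hl

theorem transLowerCentral_omega0_sq_eq_bot (kap : Fin 2 → Fin 2 → ℝ)
    (hkap : ∀ m j, ∑ i, ell i m * kap i j = if m = j then 1 else 0)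
    (hellR : ∀ i j, ell i j ∈ R)
    (hev : ∀ i, ev i ≠ 0) (hevR : ∀ i, ev i ∈ R) (hevR' : ∀ i, (ev i)⁻¹ ∈ R)
    (hφ : ∀ i g, linearCoeff ell i (φ g) = ev i * linearCoeff ell i g)
    (hR : ∀ l : List (Fin 2), ∀ x,
      (∀ n : ℕ, ∃ r ∈ R, x = ((l.map ev).prod - 1) ^ n * r) → x = 0) :
    transLowerCentral (FreeByZ φ) (Ordinal.omega0 ^ 2) = ⊥ := by
  have hone : (1 : Ordinal.{0}) ≤ 1 + 1 := le_self_add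
  -- The start is `γ₂`, which lies in `F₂` because the quotient `ℤ` is abelian; the shift is then
  -- absorbed by `1 + ω = ω`.
  have h2 : ∀ u ∈ transLowerCentral (FreeByZ φ) (1 + 1), ∃ g, SemidirectProduct.inl g = u ∧
      MonoidAlgebra.of ℝ _ g - 1 ∈ augmentation (FreeGroup (Fin 2)) ^ 1 := by
    intro u hu
    rw [transLowerCentral_add_one _ _ le_rfl, transLowerCentral_one, ← commutator_def] at hu
    have hu' := Abelianization.commutator_subset_ker (SemidirectProduct.rightHom :
      FreeByZ φ →* Multiplicative ℤ) hu
    rw [← SemidirectProduct.range_inl_eq_ker_rightHom] at hu'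
    obtain ⟨g, rfl⟩ := hu'
    exact ⟨g, rfl, by rw [pow_one]; exact of_sub_one_mem_augmentation g⟩
  have step := transLowerCentral_add_omega0_le kap hkap hellR hev hevR hevR' hφ hR
  have key (k : ℕ) : ∀ u ∈ transLowerCentral (FreeByZ φ) (Ordinal.omega0 * (k + 1 : ℕ)),
      ∃ g, SemidirectProduct.inl g = u ∧
      MonoidAlgebra.of ℝ _ g - 1 ∈ augmentation (FreeGroup (Fin 2)) ^ (k + 2) := by
    induction k with
    | zero =>
      have h := step 1 le_rfl (1 + 1) hone h2
      rw [add_assoc, Ordinal.one_add_omega0, Ordinal.one_add_omega0] at h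
      simpa only [zero_add, Nat.cast_one, mul_one] using h
    | succ k ih =>
      rw [Nat.cast_succ (k + 1), mul_add_one]
      refine step (k + 2) (by omega) _ ?_ ih
      rw [Order.one_le_iff_ne_zero]
      exact mul_ne_zero Ordinal.omega0_ne_zero (by exact_mod_cast k.succ_ne_zero)
  rw [eq_bot_iff]
  intro u hu
  obtain ⟨g, rfl, -⟩ := key 0 u (transLowerCentral_omega0_sq_le _ _ hu)
  rw [Subgroup.mem_bot, ← map_one SemidirectProduct.inl]
  congr 1
  refine eq_one_of_forall_mem_augmentation_pow g fun k => ?_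
  obtain ⟨g', hg', h⟩ := key k _ (transLowerCentral_omega0_sq_le _ _ hu)
  rw [SemidirectProduct.inl_injective hg'] at h
  exact augmentation_pow_antitone (by omega) (by omega) h

end Filtration

/-! ### Arithmetic of `ℤ[T]/(T² - sT - 1)`. -/

section Quadratic

variable (s : ℤ)

/-- The positive root of `T² - s T - 1`. -/
noncomputable def posRoot : ℝ := (s + √((s : ℝ) ^ 2 + 4)) / 2

/-- The negative root of `T² - s T - 1`. -/
noncomputable def negRoot : ℝ := (s - √((s : ℝ) ^ 2 + 4)) / 2

theorem sq_sqrt_disc : √((s : ℝ) ^ 2 + 4) ^ 2 = (s : ℝ) ^ 2 + 4 := Real.sq_sqrt (by positivity)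

theorem posRoot_mul_self : posRoot s * posRoot s = 1 + s * posRoot s := by
  rw [posRoot]; linear_combination sq_sqrt_disc s / 4

theorem negRoot_mul_self : negRoot s * negRoot s = 1 + s * negRoot s := by
  rw [negRoot]; linear_combination sq_sqrt_disc s / 4

theorem posRoot_mul_negRoot : posRoot s * negRoot s = -1 := by
  rw [posRoot, negRoot]; linear_combination -sq_sqrt_disc s / 4

theorem abs_lt_sqrt_disc : |(s : ℝ)| < √((s : ℝ) ^ 2 + 4) :=
  Real.lt_sqrt_of_sq_lt (by rw [sq_abs]; linarith)

theorem posRoot_pos : 0 < posRoot s := by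
  have := (abs_lt.mp (abs_lt_sqrt_disc s)).1
  rw [posRoot]; linarith

theorem negRoot_neg : negRoot s < 0 := by
  have := (abs_lt.mp (abs_lt_sqrt_disc s)).2
  rw [negRoot]; linarith

/-- The embedding of `ℤ[T]/(T² - s T - 1)` in `ℝ` given by the positive root. -/
noncomputable def quadraticEmbedding : QuadraticAlgebra ℤ 1 s →ₐ[ℤ] ℝ :=
  QuadraticAlgebra.lift ⟨posRoot s, by simpa using posRoot_mul_self s⟩

theorem quadraticEmbedding_omega : quadraticEmbedding s QuadraticAlgebra.omega = posRoot s := by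
  simp [quadraticEmbedding]

theorem star_omega_eq :
    star (QuadraticAlgebra.omega : QuadraticAlgebra ℤ 1 s) = (s : QuadraticAlgebra ℤ 1 s) -
      QuadraticAlgebra.omega := by
  ext <;> simp

theorem quadraticEmbedding_star_omega :
    quadraticEmbedding s (star QuadraticAlgebra.omega) = negRoot s := by
  rw [star_omega_eq, map_sub, quadraticEmbedding_omega, map_intCast, posRoot, negRoot]
  ring

variable {s}

/-- A nonzero isotropic element would make `s² + 4` a square. It lies strictly between `s²` and
`(|s| + 2)²` when `s ≠ 0`, and equality with `(|s| + 1)²` fails by parity. -/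
theorem quadratic_norm_eq_zero (hodd : Odd s) {z : QuadraticAlgebra ℤ 1 s}
    (hz : QuadraticAlgebra.norm z = 0) : z = 0 := by
  rw [QuadraticAlgebra.norm_def] at hz
  have h2 : z.im = 0 := by
    by_contra him
    have h1 : (2 * z.re + s * z.im) ^ 2 = (s ^ 2 + 4) * z.im ^ 2 := by
      linear_combination 4 * hz
    have h3 : z.im ∣ 2 * z.re + s * z.im := by
      rw [← Int.pow_dvd_pow_iff two_ne_zero, h1]
      exact dvd_mul_left _ _
    obtain ⟨q, hq⟩ := h3
    rw [hq, mul_pow, mul_comm] at h1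
    have h4 : q ^ 2 = s ^ 2 + 4 := mul_right_cancel₀ (pow_ne_zero 2 him) h1
    have hs0 : s ≠ 0 := by rintro rfl; simp at hodd
    have h5 : |s| < |q| := sq_lt_sq.mp (by linarith)
    have h6 : |q| < |s| + 2 := by
      have : 0 < |s| := abs_pos.mpr hs0
      refine lt_of_pow_lt_pow_left₀ 2 (by linarith) ?_
      rw [sq_abs, h4, add_sq, sq_abs]
      linarith
    have h7 : |q| = |s| + 1 := by omega
    have h8 : |q| ^ 2 = (|s| + 1) ^ 2 := by rw [h7]
    rw [sq_abs, h4, add_sq, sq_abs] at h8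
    omega
  have h3 : z.re = 0 := by simpa [h2] using hz
  ext <;> simp [h2, h3]

theorem quadraticEmbedding_mul_star (z : QuadraticAlgebra ℤ 1 s) :
    quadraticEmbedding s z * quadraticEmbedding s (star z) =
      ((QuadraticAlgebra.norm z : ℤ) : ℝ) := by
  rw [← map_mul, ← QuadraticAlgebra.algebraMap_norm_eq_mul_star, AlgHom.commutes]
  simp

theorem quadraticEmbedding_injective (hodd : Odd s) :
    Function.Injective (quadraticEmbedding s) := by
  rw [injective_iff_map_eq_zero]
  intro z hz
  have h := quadraticEmbedding_mul_star z
  rw [hz, zero_mul] at h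
  exact quadratic_norm_eq_zero hodd (by exact_mod_cast h.symm)

/-- The numbers `λⁱ μʲ - 1`, for `λ, μ` the roots of `T² - s T - 1`, are never units. -/
theorem not_isUnit_norm (hodd : Odd s) (h1 : s ≠ 1) (h2 : s ≠ -1) (i j : ℕ) :
    ¬ IsUnit (QuadraticAlgebra.norm ((QuadraticAlgebra.omega : QuadraticAlgebra ℤ 1 s) ^ i *
      star QuadraticAlgebra.omega ^ j - 1)) := by
  intro hunit
  set z := (QuadraticAlgebra.omega : QuadraticAlgebra ℤ 1 s) ^ i *
      star QuadraticAlgebra.omega ^ j - 1 with hz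
  have hstar : star z = star QuadraticAlgebra.omega ^ i * QuadraticAlgebra.omega ^ j - 1 := by
    simp [hz, mul_comm]
  -- For `i, j` both odd, `λ^i μ^j` and its conjugate are negative, so the norm of the difference
  -- with 1 exceeds 1.
  by_cases hij : Odd i ∧ Odd j
  · have h := quadraticEmbedding_mul_star z
    rw [hstar, hz, map_sub, map_sub, map_mul, map_mul, map_pow, map_pow, map_pow, map_pow,
      quadraticEmbedding_omega, quadraticEmbedding_star_omega, map_one, ← hz] at h
    have e1 : posRoot s ^ i * negRoot s ^ j < 0 :=
      mul_neg_of_pos_of_neg (pow_pos (posRoot_pos s) i) (hij.2.pow_neg (negRoot_neg s))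
    have e2 : negRoot s ^ i * posRoot s ^ j < 0 :=
      mul_neg_of_neg_of_pos (hij.1.pow_neg (negRoot_neg s)) (pow_pos (posRoot_pos s) j)
    have e3 : (1 : ℝ) < ((QuadraticAlgebra.norm z : ℤ) : ℝ) := by rw [← h]; nlinarith
    have e4 : 1 < QuadraticAlgebra.norm z := by exact_mod_cast e3
    rcases Int.isUnit_iff.mp hunit with h | h <;> omega
  -- Modulo `s` the polynomial becomes `T² - 1`, so the roots may be sent to `1` and `-1`. If `j` is
  -- even `z` maps to 0, if `i` is even `star z` does, and the target is nonzero because `|s| ≠ 1`.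
  · have hs0 : s ≠ 0 := by rintro rfl; simp at hodd
    have hcast : ((s : ℤ) : ZMod s.natAbs) = 0 := by
      rw [ZMod.intCast_zmod_eq_zero_iff_dvd]; simp
    let f : QuadraticAlgebra ℤ 1 s →ₐ[ℤ] ZMod s.natAbs :=
      QuadraticAlgebra.lift ⟨1, by simp [hcast]⟩
    have f1 : f QuadraticAlgebra.omega = 1 := by simp [f]
    have f2 : f (star QuadraticAlgebra.omega) = -1 := by
      rw [star_omega_eq, map_sub, f1, map_intCast, hcast, zero_sub]
    have hf : IsUnit (f z * f (star z)) := by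
      rw [← map_mul, ← QuadraticAlgebra.algebraMap_norm_eq_mul_star]
      exact (hunit.map _).map f
    have hnt : Nontrivial (ZMod s.natAbs) := ZMod.nontrivial_iff.mpr (by omega)
    rw [not_and_or, Nat.not_odd_iff_even, Nat.not_odd_iff_even] at hij
    suffices h0 : f z * f (star z) = 0 from not_isUnit_zero (h0 ▸ hf)
    rcases hij with h | h
    · rw [hstar, map_sub, map_sub, map_mul, map_mul, map_pow, map_pow, map_pow, map_pow, f1, f2,
        h.neg_one_pow]
      simp
    · rw [hstar, map_sub, map_sub, map_mul, map_mul, map_pow, map_pow, map_pow, map_pow, f1, f2,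
        h.neg_one_pow]
      simp

theorem prod_map_omega (l : List (Fin 2)) : ∃ i j : ℕ,
    (l.map ![posRoot s, negRoot s]).prod = quadraticEmbedding s (QuadraticAlgebra.omega ^ i *
      star QuadraticAlgebra.omega ^ j) := by
  simp only [map_mul, map_pow, quadraticEmbedding_omega, quadraticEmbedding_star_omega]
  induction l with
  | nil => exact ⟨0, 0, by simp⟩
  | cons a l ih =>
    obtain ⟨i, j, h⟩ := ih
    rw [List.map_cons, List.prod_cons, h]
    fin_cases a
    · exact ⟨i + 1, j, by simp; ring⟩
    · exact ⟨i, j + 1, by simp; ring⟩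

/-- Norms reduce the question to `ℤ`: an integer divisible by all powers of a non-unit is zero. This
includes the case `χ = 1`, where the norm of `χ - 1` is 0. -/
theorem eq_zero_of_forall_pow_dvd (hodd : Odd s) (h1 : s ≠ 1) (h2 : s ≠ -1) (l : List (Fin 2))
    (x : ℝ) (hx : ∀ n : ℕ, ∃ r ∈ (quadraticEmbedding s).toRingHom.range,
      x = ((l.map ![posRoot s, negRoot s]).prod - 1) ^ n * r) : x = 0 := by
  obtain ⟨i, j, hl⟩ := prod_map_omega (s := s) l
  obtain ⟨_, ⟨z, rfl⟩, hz⟩ := hx 0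
  rw [pow_zero, one_mul] at hz
  have hdvd (n : ℕ) : QuadraticAlgebra.norm ((QuadraticAlgebra.omega : QuadraticAlgebra ℤ 1 s) ^ i *
      star QuadraticAlgebra.omega ^ j - 1) ^ n ∣ QuadraticAlgebra.norm z := by
    obtain ⟨_, ⟨w, rfl⟩, hw⟩ := hx n
    refine ⟨QuadraticAlgebra.norm w, ?_⟩
    rw [← map_pow, ← map_mul]
    congr 1
    apply quadraticEmbedding_injective hodd
    rw [map_mul, map_pow, map_sub, ← hl, map_one]
    exact hz.symm.trans hw
  have hz0 : QuadraticAlgebra.norm z = 0 := by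
    by_contra hne
    obtain ⟨n, hn⟩ := Int.finiteMultiplicity_iff.mpr
      ⟨fun h => not_isUnit_norm hodd h1 h2 i j (Int.isUnit_iff_natAbs_eq.mpr h), hne⟩
    exact hn (hdvd (n + 1))
  rw [hz, quadratic_norm_eq_zero hodd hz0]
  exact map_zero _

end Quadratic

/-! ### Eigenvectors of the induced matrix and conclusion. -/

theorem transLowerCentral_freeByZ_omega0_sq (φ : MulAut (FreeGroup (Fin 2)))
    (hdet : (inducedMatrix φ).det = -1)
    (hodd : Odd (inducedMatrix φ).trace)
    (htr1 : (inducedMatrix φ).trace ≠ 1)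
    (htr2 : (inducedMatrix φ).trace ≠ -1) :
    transLowerCentral (FreeByZ φ) (Ordinal.omega0 ^ 2) = ⊥ := by
  have hR := eq_zero_of_forall_pow_dvd hodd htr1 htr2
  have hp := posRoot_mul_self (inducedMatrix φ).trace
  have hn := negRoot_mul_self (inducedMatrix φ).trace
  have hpn := posRoot_mul_negRoot (inducedMatrix φ).trace
  have hp0 := posRoot_pos (inducedMatrix φ).trace
  have hn0 := negRoot_neg (inducedMatrix φ).trace
  have hpR : posRoot (inducedMatrix φ).trace ∈
      (quadraticEmbedding (inducedMatrix φ).trace).toRingHom.range :=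
    ⟨_, quadraticEmbedding_omega _⟩
  have hnR : negRoot (inducedMatrix φ).trace ∈
      (quadraticEmbedding (inducedMatrix φ).trace).toRingHom.range :=
    ⟨_, quadraticEmbedding_star_omega _⟩
  have htr := inducedMatrix_trace φ
  rw [inducedMatrix_det] at hdet
  have hφ0 := expSum_map φ 0
  have hφ1 := expSum_map φ 1
  generalize (inducedMatrix φ).trace = s at *
  generalize inducedMatrix φ 0 0 = a at *
  generalize inducedMatrix φ 0 1 = b at *
  generalize inducedMatrix φ 1 0 = c at *
  generalize inducedMatrix φ 1 1 = d at *
  generalize posRoot s = p at *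
  generalize negRoot s = q at *
  generalize (quadraticEmbedding s).toRingHom.range = R at *
  -- With `c = 0` the diagonal entries are `1` and `-1`, and the trace would be 0, which is even.
  have hc : c ≠ 0 := by
    rintro rfl
    have had : a * d = -1 := by linarith
    rcases Int.mul_eq_neg_one_iff_eq_one_or_neg_one.mp had with ⟨rfl, rfl⟩ | ⟨rfl, rfl⟩ <;>
      simp [htr] at hodd
  have hc' : (c : ℝ) ≠ 0 := by exact_mod_cast hc
  have hqp : q - p ≠ 0 := by linarith
  have hdetR : (a * d - b * c : ℝ) = -1 := by exact_mod_cast hdet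
  have htrR : (s : ℝ) = a + d := by exact_mod_cast htr
  rw [htrR] at hp hn
  -- The rows `(c, p - a)` and `(c, q - a)` are left eigenvectors with entries in `R`. Their
  -- determinant is `c (q - p) ≠ 0`, and the second matrix is the inverse transpose; its entries
  -- need not lie in `R`.
  refine transLowerCentral_omega0_sq_eq_bot (ell := ![![c, p - a], ![c, q - a]]) (ev := ![p, q])
    (R := R) ![![(q - a) / (c * (q - p)), -c / (c * (q - p))],
      ![-(p - a) / (c * (q - p)), c / (c * (q - p))]] ?_ ?_ ?_ ?_ ?_ ?_ hR
  · intro m j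
    fin_cases m <;> fin_cases j <;> simp [Fin.sum_univ_two] <;> field_simp <;> ring
  · intro i j
    fin_cases i <;> fin_cases j
    · exact intCast_mem R c
    · exact sub_mem hpR (intCast_mem R a)
    · exact intCast_mem R c
    · exact sub_mem hnR (intCast_mem R a)
  · intro i
    fin_cases i
    · exact hp0.ne'
    · exact hn0.ne
  · intro i
    fin_cases i
    · exact hpR
    · exact hnR
  · intro i
    fin_cases i
    -- The relation `p q = -1` makes both eigenvalues units of `R`.
    · change p⁻¹ ∈ R
      rw [inv_eq_of_mul_eq_one_right (b := -q) (by linarith)]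
      exact neg_mem hnR
    · change q⁻¹ ∈ R
      rw [inv_eq_of_mul_eq_one_right (b := -p) (by linarith)]
      exact neg_mem hpR
  · intro i g
    fin_cases i <;>
      simp only [linearCoeff, hφ0, hφ1, Int.cast_add, Int.cast_mul] <;> simp
    · linear_combination (-(expSum 1 g : ℝ)) * (hdetR + hp)
    · linear_combination (-(expSum 1 g : ℝ)) * (hdetR + hn)

theorem mainTheorem11 (φ : MulAut (FreeGroup (Fin 2)))
    (hdet : (inducedMatrix φ).det = -1)
    (hodd : Odd (inducedMatrix φ).trace)
    (htr1 : (inducedMatrix φ).trace ≠ 1)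
    (htr2 : (inducedMatrix φ).trace ≠ -1) :
    HasLowerCentralLength (FreeByZ φ) (Ordinal.omega0 ^ 2) ∧
      (FreeByZ.gen φ 0)⁻¹ * (FreeByZ.gen φ 1)⁻¹ * FreeByZ.gen φ 0 * FreeByZ.gen φ 1 ∈
        transLowerCentral (FreeByZ φ) Ordinal.omega0 ∧
      transLowerCentral (FreeByZ φ) Ordinal.omega0 ≠ ⊥ := by
  have hne := transLowerCentral_omega0_mul_ne_bot φ hdet hodd
  refine ⟨hasLowerCentralLength_omega0_sq _ hne
    (transLowerCentral_freeByZ_omega0_sq φ hdet hodd htr1 htr2), ?_, ?_⟩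
  · have h := genCommutator_mem_omega0 φ hdet hodd
    simp only [genCommutator, map_mul, map_inv] at h
    exact h
  · simpa using hne 1
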